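/- Let $n\ge 4$ be an integer, let $F$ be a field and let $l,r\in F$ be non-zero with $r^2\neq 1$; put $m=\frac1r-r$ (so $m\ne0$). Call nodes $i,j\in\{1,\dots,n\}$ adjacent, $i\sim j$, if $\{i,j\}=\{1,3\}$ or $\{i,j\}=\{k,k+1\}$ with $k\ge 2$ (Dynkin diagram $D_n$). *The algebra.* $CGW(D_n)$ is the unital associative $F$-algebra with generators $g_1,\dots,g_n,e_1,\dots,e_n$ and relations $g_ig_jg_i=g_jg_ig_j$ for $i\sim j$, $g_ig_j=g_jg_i$ for $i\not\sim j$, $m\,e_i=l(g_i^2+m g_i-1)$, $g_ie_i=\frac1l e_i$ for all $i$, and $e_ig_je_i=l\,e_i$ for $i\sim j$. The $g_i$ are invertible. Let $g_{s,t}$ (resp. $g^\star_{s,t}$) be the product of the $g_k$ (resp. $g_k^{-1}$) with $k$ running along the integer path from $s$ up or down to $t$, and put $$C_{i,i+1}=e_{i+1}\ (1\le i\le n-1),\qquad C_{ij}=g_{j,i+2}\,e_{i+1}\,g^\star_{i+2,j}\ (1\le i,\ i+2\le j\le n),$$ $$\widehat{C}_{12}=e_1,\qquad \widehat C_{1j}=g_{j,3}\,e_1\,g^\star_{3,j}\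 (3\le j\le n),\qquad \widehat C_{ij}=g_{i,2}\,g_{j,3}\,e_1\,g^\star_{3,j}\,g^\star_{2,i}\ (2\le i<j\le n).$$ *The representation.* $V_n$ is the $F$-vector space with basis $w_{ij},\widehat w_{ij}$ $(1\le i<j\le n)$, and $\overline{w}_{ij}$ denotes either of $w_{ij},\widehat w_{ij}$ (the same choice on both sides of an equation). The Cohen–Wales representation $\nu^{(n)}:CGW(D_n)\to\mathrm{End}_F(V_n)$ is the algebra homomorphism with $g_k\mapsto\nu_k$, where, with all index pairs increasing and in $\{1,\dots,n\}$: for $3\le i<j$, $$\begin{aligned}\nu_1\widehat w_{ij}={}&m r^{j-5}(\widehat w_{1i}-w_{1i})+m r^{j-4}(\widehat w_{2i}-w_{2i})+m r^{i-3}(\widehat w_{1j}-w_{1j})+m r^{i-2}(\widehat w_{2j}-w_{2j})\\&+m^2(r^{i+j-8}+r^{i+j-6})(\widehat w_{12}-w_{12})+r\,\widehat w_{ij};\end{aligned}$$ for $j\ge3$, $\nu_1\widehat w_{1j}=w_{2j}$, $\nu_1\widehat w_{2j}=w_{1j}+m r^{j-3}w_{12}-m w_{2j}$, $\nu_1w_{2j}=\widehat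 w_{1j}+m r^{j-3}\widehat w_{12}-m w_{2j}$, $\nu_1w_{1j}=\widehat w_{2j}+m r^{j-4}(\widehat w_{12}-w_{12})+m(\widehat w_{1j}-w_{1j})$; $\nu_1\widehat w_{12}=\frac1l\widehat w_{12}$; and $\nu_1$ multiplies the other basis vectors by $r$. For $2\le k\le n$: $\nu_k\overline w_{k-1,t}=\overline w_{k,t}$ for $t\ge k+1$; $\nu_k\overline w_{s,k-1}=\overline w_{s,k}$; $\nu_k\widehat w_{k-1,k}=r\widehat w_{k-1,k}$; $\nu_kw_{k-1,k}=\frac1lw_{k-1,k}$; for $t\ge k+1$, $\nu_k\widehat w_{k,t}=\widehat w_{k-1,t}+\frac ml r^{t-k-2}w_{k-1,k}-m\widehat w_{k,t}$ and $\nu_kw_{k,t}=w_{k-1,t}+m r^{t-k-1}w_{k-1,k}-m w_{k,t}$; for $s\le k-2$, $\nu_k\overline w_{s,k}=\overline w_{s,k-1}+\frac{m}{l\,r^{k-s-2}}w_{k-1,k}-m\overline w_{s,k}$; and $\nu_k$ multiplies the other basis vectors by $r$. Let $$K(n)=\bigcap_{1\le i<j\le n}\ker\nu^{(n)}(C_{ij})\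 \cap\bigcap_{1\le i<j\le n}\ker\nu^{(n)}(\widehat C_{ij}).$$ **Theorem.** $K(n)$ is a $CGW(D_n)$-submodule of $V_n$. Moreover: (i) If $l=r^3$, then the non-zero vector $$X=(w_{24}+r^2\widehat w_{24})-r(w_{14}+r^2\widehat w_{14})-r(w_{23}+r^2\widehat w_{23})+r^2(w_{13}+r^2\widehat w_{13})$$ belongs to $K(n)$, and $\nu^{(n)}$ is reducible. (ii) If $l=-r^3$, then for $n\ge5$ the non-zero vector $Y=w_{34}-\frac1r w_{35}+\frac1{r^2}w_{45}$ belongs to $K(n)$, for $n=4$ the non-zero vector $Z=r^3\widehat w_{24}-r^2\widehat w_{34}+w_{23}$ belongs to $K(4)$, and $\nu^{(n)}$ is reducible for every $n\ge4$. (iii) If $l=-\frac1{r^{2n-5}}$, then the non-zero vector $$J_n=(\widehat w_{12}+r^{2n-6}w_{12})-\frac1r(\widehat w_{13}+r^{2n-6}w_{13})-(1+r^{2n-6})w_{23}+r\sum_{j=4}^n r^{j-5}\big[(w_{3j}-\widehat w_{3j})-r(w_{2j}-\widehat w_{2j})\big]$$ belongs to $K(n)$, and $\nu^{(n)}$ is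 reducible. Here reducible means that $V_n$ has an invariant subspace other than $0$ and $V_n$. -/

import Mathlib

namespace CohenWales

/-- Nodes `1, …, n` of the Dynkin diagram of type `D_n`. -/
abbrev Node (n : ℕ) := {k : ℕ // 1 ≤ k ∧ k ≤ n}

/-- Adjacency in the Dynkin diagram of type `D_n`: the nodes `2 - 3 - ⋯ - n` form a path and
the node `1` is joined to the node `3` only. -/
def Adj (i j : ℕ) : Prop :=
  (i = 1 ∧ j = 3) ∨ (i = 3 ∧ j = 1) ∨ (2 ≤ i ∧ j = i + 1) ∨ (2 ≤ j ∧ i = j + 1)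

/-- Generators of the CGW algebra. -/
inductive Gen (n : ℕ) : Type
  | g (k : Node n) : Gen n
  | e (k : Node n) : Gen n

/-- Defining relations of the CGW algebra of type `D_n` with parameters `l` and `m`. -/
inductive Rel (F : Type*) [Field F] (n : ℕ) (l m : F) :
    FreeAlgebra F (Gen n) → FreeAlgebra F (Gen n) → Prop
  | braid (i j : Node n) (h : Adj i j) : Rel F n l m
      (FreeAlgebra.ι F (Gen.g i) * FreeAlgebra.ι F (Gen.g j) * FreeAlgebra.ι F (Gen.g i))
      (FreeAlgebra.ι F (Gen.g j) * FreeAlgebra.ι F (Gen.g i) * FreeAlgebra.ι F (Gen.g j))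
  | comm (i j : Node n) (h : ¬ Adj i j) : Rel F n l m
      (FreeAlgebra.ι F (Gen.g i) * FreeAlgebra.ι F (Gen.g j))
      (FreeAlgebra.ι F (Gen.g j) * FreeAlgebra.ι F (Gen.g i))
  | quad (i : Node n) : Rel F n l m
      (m • FreeAlgebra.ι F (Gen.e i))
      (l • (FreeAlgebra.ι F (Gen.g i) ^ 2 + m • FreeAlgebra.ι F (Gen.g i) - 1))
  | deloop (i : Node n) : Rel F n l m
      (FreeAlgebra.ι F (Gen.g i) * FreeAlgebra.ι F (Gen.e i))
      (l⁻¹ • FreeAlgebra.ι F (Gen.e i))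
  | ege (i j : Node n) (h : Adj i j) : Rel F n l m
      (FreeAlgebra.ι F (Gen.e i) * FreeAlgebra.ι F (Gen.g j) * FreeAlgebra.ι F (Gen.e i))
      (l • FreeAlgebra.ι F (Gen.e i))

/-- The Cohen-Gijsbers-Wales algebra of type `D_n` with parameters `l` and `m`. -/
abbrev CGW (F : Type*) [Field F] (n : ℕ) (l m : F) : Type _ := RingQuot (Rel F n l m)

section Algebra

variable {F : Type*} [Field F] {n : ℕ} {l m : F}

/-- The generator `g_k`, `1 ≤ k ≤ n` (and `1` if `k` is not a node). -/
noncomputable def g (F : Type*) [Field F] (n : ℕ) (l m : F) (k : ℕ) : CGW F n l m :=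
  if h : 1 ≤ k ∧ k ≤ n then
    RingQuot.mkAlgHom F (Rel F n l m) (FreeAlgebra.ι F (Gen.g ⟨k, h⟩)) else 1

/-- The generator `e_k`, `1 ≤ k ≤ n` (and `0` if `k` is not a node). -/
noncomputable def e (F : Type*) [Field F] (n : ℕ) (l m : F) (k : ℕ) : CGW F n l m :=
  if h : 1 ≤ k ∧ k ≤ n then
    RingQuot.mkAlgHom F (Rel F n l m) (FreeAlgebra.ι F (Gen.e ⟨k, h⟩)) else 0

/-- The inverse `g_k⁻¹` in the CGW algebra. -/
noncomputable def gInv (F : Type*) [Field F] (n : ℕ) (l m : F) (k : ℕ) : CGW F n l m :=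
  Ring.inverse (g F n l m k)

theorem smul_e {k : ℕ} (h1 : 1 ≤ k) (h2 : k ≤ n) :
    m • e F n l m k = l • (g F n l m k ^ 2 + m • g F n l m k - 1) := by
  have := RingQuot.mkAlgHom_rel F (Rel.quad (F := F) (l := l) (m := m) ⟨k, h1, h2⟩)
  simpa [e, g, h1, h2] using this

theorem g_mul_e {k : ℕ} (h1 : 1 ≤ k) (h2 : k ≤ n) :
    g F n l m k * e F n l m k = l⁻¹ • e F n l m k := by
  have := RingQuot.mkAlgHom_rel F (Rel.deloop (F := F) (l := l) (m := m) ⟨k, h1, h2⟩)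
  simpa [e, g, h1, h2] using this

theorem e_mul_g (hm : m ≠ 0) {k : ℕ} (h1 : 1 ≤ k) (h2 : k ≤ n) :
    e F n l m k * g F n l m k = l⁻¹ • e F n l m k := by
  rw [← g_mul_e h1 h2]
  have h : e F n l m k = m⁻¹ • l • (g F n l m k ^ 2 + m • g F n l m k - 1) := by
    rw [← smul_e h1 h2, inv_smul_smul₀ hm]
  rw [h]
  simp only [smul_mul_assoc, mul_smul_comm, sub_mul, mul_sub, add_mul, mul_add, one_mul, mul_one,
    ← pow_succ, ← pow_succ']

/-- `g_k` is invertible, with inverse `g_k + m - m e_k`. -/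
theorem isUnit_g (hl : l ≠ 0) (hm : m ≠ 0) {k : ℕ} (h1 : 1 ≤ k) (h2 : k ≤ n) :
    IsUnit (g F n l m k) ∧
      gInv F n l m k = g F n l m k + m • (1 : CGW F n l m) - m • e F n l m k := by
  have e1 : g F n l m k * (g F n l m k + m • (1 : CGW F n l m) - m • e F n l m k) = 1 := by
    rw [mul_sub, mul_smul_comm, g_mul_e h1 h2, smul_comm, smul_e h1 h2, inv_smul_smul₀ hl]
    simp only [mul_add, mul_smul_comm, mul_one, pow_two]
    abel
  have e2 : (g F n l m k + m • (1 : CGW F n l m) - m • e F n l m k) * g F n l m k = 1 := by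
    rw [sub_mul, smul_mul_assoc, e_mul_g hm h1 h2, smul_comm, smul_e h1 h2, inv_smul_smul₀ hl]
    simp only [add_mul, smul_mul_assoc, one_mul, pow_two]
    abel
  have hu : IsUnit (g F n l m k) := ⟨⟨_, _, e1, e2⟩, rfl⟩
  refine ⟨hu, ?_⟩
  calc gInv F n l m k = Ring.inverse (g F n l m k) * (g F n l m k *
        (g F n l m k + m • (1 : CGW F n l m) - m • e F n l m k)) := by rw [e1, mul_one]; rfl
    _ = _ := by rw [← mul_assoc, Ring.inverse_mul_cancel _ hu, one_mul]

/-- The integer path from `s` up or down to `t`. -/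
def path (s t : ℕ) : List ℕ :=
  if s ≤ t then List.range' s (t + 1 - s) else (List.range' t (s + 1 - t)).reverse

/-- `g_{s,t} = g_s ⋯ g_t`, the product along the path from `s` to `t`. -/
noncomputable def gProd (F : Type*) [Field F] (n : ℕ) (l m : F) (s t : ℕ) : CGW F n l m :=
  ((path s t).map (g F n l m)).prod

/-- `g*_{s,t} = g_s⁻¹ ⋯ g_t⁻¹`, the product along the path from `s` to `t`. -/
noncomputable def gStar (F : Type*) [Field F] (n : ℕ) (l m : F) (s t : ℕ) : CGW F n l m :=
  ((path s t).map (gInv F n l m)).prod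

/-- The conjugate `C_{ij}` of `e_{i+1}`, `1 ≤ i < j ≤ n`. -/
noncomputable def C (F : Type*) [Field F] (n : ℕ) (l m : F) (i j : ℕ) : CGW F n l m :=
  if j = i + 1 then e F n l m (i + 1)
  else gProd F n l m j (i + 2) * e F n l m (i + 1) * gStar F n l m (i + 2) j

/-- The conjugate `Ĉ_{ij}` of `e_1`, `1 ≤ i < j ≤ n`. -/
noncomputable def CHat (F : Type*) [Field F] (n : ℕ) (l m : F) (i j : ℕ) : CGW F n l m :=
  if i = 1 then
    if j = 2 then e F n l m 1
    else gProd F n l m j 3 * e F n l m 1 * gStar F n l m 3 j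
  else
    gProd F n l m i 2 * gProd F n l m j 3 * e F n l m 1 * gStar F n l m 3 j * gStar F n l m 2 i

end Algebra

/-- The positive roots of type `D_n`: the triple `(b, s, t)` stands for `w_{st}` if `b = false`
and for `ŵ_{st}` if `b = true`. -/
abbrev PosRoot (n : ℕ) := {p : Bool × ℕ × ℕ // 1 ≤ p.2.1 ∧ p.2.1 < p.2.2 ∧ p.2.2 ≤ n}

/-- The Cohen-Wales space `V_n`. -/
abbrev Space (F : Type*) [Field F] (n : ℕ) := PosRoot n →₀ F

/-- The basis vector `w_{st}` (`b = false`) or `ŵ_{st}` (`b = true`) for `1 ≤ s < t ≤ n`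
(and `0` for other indices). -/
noncomputable def wBar (F : Type*) [Field F] (n : ℕ) (b : Bool) (s t : ℕ) : Space F n :=
  if h : 1 ≤ s ∧ s < t ∧ t ≤ n then Finsupp.single ⟨(b, s, t), h⟩ 1 else 0

/-- `w_{st}` -/
noncomputable abbrev w (F : Type*) [Field F] (n : ℕ) (s t : ℕ) : Space F n := wBar F n false s t

/-- `ŵ_{st}` -/
noncomputable abbrev wHat (F : Type*) [Field F] (n : ℕ) (s t : ℕ) : Space F n := wBar F n true s t

/-- The image of `w̄_{st}` (`1 ≤ s < t ≤ n`) under `ν_1`; here `m = r⁻¹ - r`. -/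
noncomputable def actOne {F : Type*} [Field F] (n : ℕ) (l r : F) (b : Bool) (s t : ℕ) :
    Space F n :=
  let m : F := r⁻¹ - r
  match b with
  | true =>
    if s = 1 ∧ t = 2 then l⁻¹ • wHat F n 1 2
    else if s = 1 then w F n 2 t
    else if s = 2 then w F n 1 t + (m * r ^ ((t : ℤ) - 3)) • w F n 1 2 - m • w F n 2 t
    else
      (m * r ^ ((t : ℤ) - 5)) • (wHat F n 1 s - w F n 1 s)
        + (m * r ^ ((t : ℤ) - 4)) • (wHat F n 2 s - w F n 2 s)
        + (m * r ^ ((s : ℤ) - 3)) • (wHat F n 1 t - w F n 1 t)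
        + (m * r ^ ((s : ℤ) - 2)) • (wHat F n 2 t - w F n 2 t)
        + (m ^ 2 * (r ^ ((s : ℤ) + t - 8) + r ^ ((s : ℤ) + t - 6))) • (wHat F n 1 2 - w F n 1 2)
        + r • wHat F n s t
  | false =>
    if s = 1 ∧ t = 2 then r • w F n 1 2
    else if s = 1 then
      wHat F n 2 t + (m * r ^ ((t : ℤ) - 4)) • (wHat F n 1 2 - w F n 1 2)
        + m • (wHat F n 1 t - w F n 1 t)
    else if s = 2 then
      wHat F n 1 t + (m * r ^ ((t : ℤ) - 3)) • wHat F n 1 2 - m • w F n 2 t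
    else r • w F n s t

/-- The image of `w̄_{st}` (`1 ≤ s < t ≤ n`) under `ν_k`, where `2 ≤ k ≤ n`; here
`m = r⁻¹ - r`. -/
noncomputable def actSucc {F : Type*} [Field F] (n : ℕ) (l r : F) (k : ℕ) (b : Bool) (s t : ℕ) :
    Space F n :=
  let m : F := r⁻¹ - r
  if s + 1 = k ∧ t = k then (if b then r else l⁻¹) • wBar F n b s t
  else if s + 1 = k then wBar F n b k t
  else if t + 1 = k then wBar F n b s k
  else if s = k then
    wBar F n b (k - 1) t
      + (if b then m / l * r ^ ((t : ℤ) - k - 2) else m * r ^ ((t : ℤ) - k - 1)) • w F n (k - 1) k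
      - m • wBar F n b k t
  else if t = k then
    wBar F n b s (k - 1) + (m / (l * r ^ ((k : ℤ) - s - 2))) • w F n (k - 1) k - m • wBar F n b s k
  else r • wBar F n b s t

/-- The endomorphism `ν_k` of the Cohen-Wales space, `1 ≤ k ≤ n`. -/
noncomputable def nu {F : Type*} [Field F] (n : ℕ) (l r : F) (k : ℕ) : Module.End F (Space F n) :=
  Finsupp.linearCombination F fun p : PosRoot n =>
    if k = 1 then actOne n l r p.1.1 p.1.2.1 p.1.2.2 else actSucc n l r k p.1.1 p.1.2.1 p.1.2.2

section Rep

set_option linter.unusedSimpArgs false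
set_option linter.unnecessarySeqFocus false

variable {F : Type*} [Field F] {n : ℕ} {l r : F}

theorem nu_one (b : Bool) {s t : ℕ} (hs : 1 ≤ s) (hst : s < t) (ht : t ≤ n) :
    nu n l r 1 (wBar F n b s t) = actOne n l r b s t := by
  simp [nu, wBar, hs, hst, ht]

theorem nu_succ (b : Bool) {k s t : ℕ} (hk : 2 ≤ k) (hs : 1 ≤ s) (hst : s < t) (ht : t ≤ n) :
    nu n l r k (wBar F n b s t) = actSucc n l r k b s t := by
  have : k ≠ 1 := by omega
  simp [nu, wBar, hs, hst, ht, this]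

theorem ext_w {f f' : Module.End F (Space F n)}
    (h : ∀ b s t, 1 ≤ s → s < t → t ≤ n → f (wBar F n b s t) = f' (wBar F n b s t)) : f = f' := by
  refine Finsupp.lhom_ext' fun ⟨⟨b, s, t⟩, hp⟩ => LinearMap.ext_ring ?_
  have := h b s t hp.1 hp.2.1 hp.2.2
  have hp' : 1 ≤ s ∧ s < t ∧ t ≤ n := hp
  simpa [wBar, hp'] using this

theorem nu_succ_diag_hat {k s t : ℕ} (hk : 2 ≤ k) (h1 : s + 1 = k) (h2 : t = k) (hkn : k ≤ n) :
    nu n l r k (wBar F n true s t) = r • wBar F n true s t := by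
  rw [nu_succ _ hk (by omega) (by omega) (by omega)]; simp [actSucc, h1, h2]

theorem nu_succ_diag {k s t : ℕ} (hk : 2 ≤ k) (h1 : s + 1 = k) (h2 : t = k) (hkn : k ≤ n) :
    nu n l r k (wBar F n false s t) = l⁻¹ • wBar F n false s t := by
  rw [nu_succ _ hk (by omega) (by omega) (by omega)]; simp [actSucc, h1, h2]

theorem nu_succ_s1 {b : Bool} {k s t : ℕ} (hk : 2 ≤ k) (h1 : s + 1 = k) (h2 : k < t) (hkn : t ≤ n) :
    nu n l r k (wBar F n b s t) = wBar F n b k t := by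
  rw [nu_succ _ hk (by omega) (by omega) (by omega)]
  have : t ≠ k := by omega
  simp [actSucc, h1, this]

theorem nu_succ_t1 {b : Bool} {k s t : ℕ} (hk : 2 ≤ k) (hs : 1 ≤ s) (hst : s < t) (h1 : t + 1 = k)
    (hkn : k ≤ n) :
    nu n l r k (wBar F n b s t) = wBar F n b s k := by
  rw [nu_succ _ hk (by omega) (by omega) (by omega)]
  have : s + 1 ≠ k := by omega
  simp [actSucc, h1, this]

theorem nu_succ_s0_hat {k s t : ℕ} (hk : 2 ≤ k) (hst : s < t) (h1 : s = k) (hkn : t ≤ n) :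
    nu n l r k (wBar F n true s t) = wBar F n true (k - 1) t
      + ((r⁻¹ - r) / l * r ^ ((t : ℤ) - k - 2)) • w F n (k - 1) k - (r⁻¹ - r) • wBar F n true k t := by
  subst h1
  rw [nu_succ _ hk (by omega) (by omega) (by omega)]
  have : t + 1 ≠ s := by omega
  simp [actSucc, this]

theorem nu_succ_s0 {k s t : ℕ} (hk : 2 ≤ k) (hst : s < t) (h1 : s = k) (hkn : t ≤ n) :
    nu n l r k (wBar F n false s t) = wBar F n false (k - 1) t
      + ((r⁻¹ - r) * r ^ ((t : ℤ) - k - 1)) • w F n (k - 1) k - (r⁻¹ - r) • wBar F n false k t := by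
  subst h1
  rw [nu_succ _ hk (by omega) (by omega) (by omega)]
  have : t + 1 ≠ s := by omega
  simp [actSucc, this]

theorem nu_succ_t0 {b : Bool} {k s t : ℕ} (hs : 1 ≤ s) (hst : s + 1 < t) (h1 : t = k) (hkn : k ≤ n) :
    nu n l r k (wBar F n b s t) = wBar F n b s (k - 1)
      + ((r⁻¹ - r) / (l * r ^ ((k : ℤ) - s - 2))) • w F n (k - 1) k - (r⁻¹ - r) • wBar F n b s k := by
  subst h1
  rw [nu_succ _ (by omega) (by omega) (by omega) (by omega)]
  have h1 : s + 1 ≠ t := by omega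
  have h2 : s ≠ t := by omega
  simp [actSucc, h1, h2]

theorem nu_succ_far {b : Bool} {k s t : ℕ} (hk : 2 ≤ k) (hs : 1 ≤ s) (hst : s < t) (hkn : t ≤ n)
    (h1 : s ≠ k) (h2 : s + 1 ≠ k) (h3 : t ≠ k) (h4 : t + 1 ≠ k) :
    nu n l r k (wBar F n b s t) = r • wBar F n b s t := by
  rw [nu_succ _ hk (by omega) (by omega) (by omega)]
  simp [actSucc, h1, h2, h3, h4]

theorem nu_one_12_hat (hn : 2 ≤ n) :
    nu n l r 1 (wBar F n true 1 2) = l⁻¹ • wBar F n true 1 2 := by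
  rw [nu_one _ (by omega) (by omega) (by omega)]; simp [actOne]

theorem nu_one_12 (hn : 2 ≤ n) :
    nu n l r 1 (wBar F n false 1 2) = r • wBar F n false 1 2 := by
  rw [nu_one _ (by omega) (by omega) (by omega)]; simp [actOne]

theorem nu_one_1_hat {t : ℕ} (h : 3 ≤ t) (hn : t ≤ n) :
    nu n l r 1 (wBar F n true 1 t) = wBar F n false 2 t := by
  rw [nu_one _ (by omega) (by omega) (by omega)]
  have : t ≠ 2 := by omega
  simp [actOne, this]

theorem nu_one_2_hat {t : ℕ} (h : 3 ≤ t) (hn : t ≤ n) :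
    nu n l r 1 (wBar F n true 2 t) = w F n 1 t + ((r⁻¹ - r) * r ^ ((t : ℤ) - 3)) • w F n 1 2
      - (r⁻¹ - r) • w F n 2 t := by
  rw [nu_one _ (by omega) (by omega) (by omega)]
  simp [actOne]

theorem nu_one_1 {t : ℕ} (h : 3 ≤ t) (hn : t ≤ n) :
    nu n l r 1 (wBar F n false 1 t) =
      wHat F n 2 t + ((r⁻¹ - r) * r ^ ((t : ℤ) - 4)) • (wHat F n 1 2 - w F n 1 2)
        + (r⁻¹ - r) • (wHat F n 1 t - w F n 1 t) := by
  rw [nu_one _ (by omega) (by omega) (by omega)]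
  have : t ≠ 2 := by omega
  simp [actOne, this]

theorem nu_one_2 {t : ℕ} (h : 3 ≤ t) (hn : t ≤ n) :
    nu n l r 1 (wBar F n false 2 t) =
      wHat F n 1 t + ((r⁻¹ - r) * r ^ ((t : ℤ) - 3)) • wHat F n 1 2 - (r⁻¹ - r) • w F n 2 t := by
  rw [nu_one _ (by omega) (by omega) (by omega)]
  simp [actOne]

theorem nu_one_far {s t : ℕ} (h : 3 ≤ s) (hst : s < t) (hn : t ≤ n) :
    nu n l r 1 (wBar F n false s t) = r • w F n s t := by
  rw [nu_one _ (by omega) (by omega) (by omega)]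
  have h1 : s ≠ 1 := by omega
  have h2 : s ≠ 2 := by omega
  simp [actOne, h1, h2]

theorem nu_one_far_hat {s t : ℕ} (h : 3 ≤ s) (hst : s < t) (hn : t ≤ n) :
    nu n l r 1 (wBar F n true s t) =
      ((r⁻¹ - r) * r ^ ((t : ℤ) - 5)) • (wHat F n 1 s - w F n 1 s)
        + ((r⁻¹ - r) * r ^ ((t : ℤ) - 4)) • (wHat F n 2 s - w F n 2 s)
        + ((r⁻¹ - r) * r ^ ((s : ℤ) - 3)) • (wHat F n 1 t - w F n 1 t)
        + ((r⁻¹ - r) * r ^ ((s : ℤ) - 2)) • (wHat F n 2 t - w F n 2 t)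
        + ((r⁻¹ - r) ^ 2 * (r ^ ((s : ℤ) + t - 8) + r ^ ((s : ℤ) + t - 6))) •
          (wHat F n 1 2 - w F n 1 2)
        + r • wHat F n s t := by
  rw [nu_one _ (by omega) (by omega) (by omega)]
  have h1 : s ≠ 1 := by omega
  have h2 : s ≠ 2 := by omega
  simp [actOne, h1, h2]

set_option maxHeartbeats 4000000 in
theorem braid_succ (hr : r ≠ 0) (hl : l ≠ 0) {j : ℕ} (hj : 1 ≤ j) (hjn : j + 2 ≤ n) :
    nu n l r (j + 1) * nu n l r (j + 2) * nu n l r (j + 1) =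
      nu n l r (j + 2) * nu n l r (j + 1) * nu n l r (j + 2) := by
  refine ext_w fun b s t hs hst ht => ?_
  simp only [Module.End.mul_apply]
  have key : ∀ x : ℕ, x < j ∨ x = j ∨ x = j + 1 ∨ x = j + 2 ∨ j + 2 < x := by omega
  have e1 : j + 2 - 1 = j + 1 := rfl
  rcases key s with h1 | rfl | rfl | rfl | h1 <;> rcases key t with h2 | rfl | rfl | rfl | h2 <;>
  first
  | omega
  | cases b <;>
    · simp (disch := omega) only [nu_succ_diag_hat, nu_succ_diag, nu_succ_s1, nu_succ_t1,
        nu_succ_s0_hat, nu_succ_s0, nu_succ_t0, nu_succ_far, w, map_add, map_sub, map_smul,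
        Nat.add_sub_cancel, e1]
      all_goals try
        simp only [Nat.cast_add, Nat.cast_one, Nat.cast_ofNat, zpow_add₀ hr, zpow_sub₀ hr, zpow_natCast,
          zpow_ofNat]
      all_goals try (match_scalars <;> field_simp <;> ring)

set_option maxHeartbeats 4000000 in
theorem comm_succ (hr : r ≠ 0) (hl : l ≠ 0) {i j : ℕ} (hi : 1 ≤ i) (hij : i + 2 ≤ j)
    (hjn : j + 1 ≤ n) :
    nu n l r (i + 1) * nu n l r (j + 1) = nu n l r (j + 1) * nu n l r (i + 1) := by
  refine ext_w fun b s t hs hst ht => ?_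
  simp only [Module.End.mul_apply]
  have key : ∀ x : ℕ, x = i ∨ x = i + 1 ∨ x = j ∨ x = j + 1 ∨
      (x ≠ i ∧ x ≠ i + 1 ∧ x ≠ j ∧ x ≠ j + 1) := by omega
  rcases key s with rfl | rfl | rfl | rfl | h1 <;> rcases key t with rfl | rfl | rfl | rfl | h2 <;>
  first
  | omega
  | cases b <;>
    · simp (disch := omega) only [nu_succ_diag_hat, nu_succ_diag, nu_succ_s1, nu_succ_t1,
        nu_succ_s0_hat, nu_succ_s0, nu_succ_t0, nu_succ_far, w, map_add, map_sub, map_smul,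
        Nat.add_sub_cancel]
      all_goals try
        simp only [Nat.cast_add, Nat.cast_one, Nat.cast_ofNat, zpow_add₀ hr, zpow_sub₀ hr,
          zpow_natCast, zpow_ofNat]
      all_goals try (match_scalars <;> field_simp <;> ring)

set_option maxHeartbeats 4000000 in
theorem comm_one (hr : r ≠ 0) (hl : l ≠ 0) {j : ℕ} (hj : 3 ≤ j) (hjn : j + 1 ≤ n) :
    nu n l r 1 * nu n l r (j + 1) = nu n l r (j + 1) * nu n l r 1 := by
  refine ext_w fun b s t hs hst ht => ?_
  simp only [Module.End.mul_apply]
  have key : ∀ x : ℕ, 1 ≤ x → x = 1 ∨ x = 2 ∨ x = j ∨ x = j + 1 ∨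
      (3 ≤ x ∧ x ≠ j ∧ x ≠ j + 1) := by omega
  rcases key s hs with rfl | rfl | rfl | rfl | h1 <;>
  rcases key t (by omega) with rfl | rfl | rfl | rfl | h2 <;>
  first
  | omega
  | cases b <;>
    · simp (disch := omega) only [nu_succ_diag_hat, nu_succ_diag, nu_succ_s1, nu_succ_t1,
        nu_succ_s0_hat, nu_succ_s0, nu_succ_t0, nu_succ_far, nu_one_12_hat, nu_one_12,
        nu_one_1_hat, nu_one_2_hat, nu_one_1, nu_one_2, nu_one_far, nu_one_far_hat,
        w, wHat, map_add, map_sub, map_smul, Nat.add_sub_cancel]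
      all_goals try
        simp only [Nat.cast_add, Nat.cast_one, Nat.cast_ofNat, zpow_add₀ hr, zpow_sub₀ hr,
          zpow_natCast, zpow_ofNat, zpow_one]
      all_goals try (match_scalars <;> field_simp <;> ring)

set_option maxHeartbeats 4000000 in
theorem comm_one_two (hr : r ≠ 0) (hl : l ≠ 0) (hn : 2 ≤ n) :
    nu n l r 1 * nu n l r 2 = nu n l r 2 * nu n l r 1 := by
  refine ext_w fun b s t hs hst ht => ?_
  simp only [Module.End.mul_apply]
  have key : ∀ x : ℕ, 1 ≤ x → x = 1 ∨ x = 2 ∨ 3 ≤ x := by omega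
  rcases key s hs with rfl | rfl | h1 <;>
  rcases key t (by omega) with rfl | rfl | h2 <;>
  first
  | omega
  | cases b <;>
    · simp (disch := omega) only [nu_succ_diag_hat, nu_succ_diag, nu_succ_s1, nu_succ_t1,
        nu_succ_s0_hat, nu_succ_s0, nu_succ_t0, nu_succ_far, nu_one_12_hat, nu_one_12,
        nu_one_1_hat, nu_one_2_hat, nu_one_1, nu_one_2, nu_one_far, nu_one_far_hat,
        w, wHat, map_add, map_sub, map_smul, Nat.add_one_sub_one]
      all_goals try
        simp only [Nat.reduceSub, Nat.cast_add, Nat.cast_one, Nat.cast_ofNat, zpow_add₀ hr,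
          zpow_sub₀ hr, zpow_natCast, zpow_ofNat, zpow_one]
      all_goals try (match_scalars <;> field_simp <;> ring)

set_option maxHeartbeats 4000000 in
theorem braid_one_three (hr : r ≠ 0) (hl : l ≠ 0) (hn : 3 ≤ n) :
    nu n l r 1 * nu n l r 3 * nu n l r 1 = nu n l r 3 * nu n l r 1 * nu n l r 3 := by
  refine ext_w fun b s t hs hst ht => ?_
  simp only [Module.End.mul_apply]
  have key : ∀ x : ℕ, 1 ≤ x → x = 1 ∨ x = 2 ∨ x = 3 ∨ 4 ≤ x := by omega
  rcases key s hs with rfl | rfl | rfl | h1 <;>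
  rcases key t (by omega) with rfl | rfl | rfl | h2 <;>
  first
  | omega
  | cases b <;>
    · simp (disch := omega) only [nu_succ_diag_hat, nu_succ_diag, nu_succ_s1, nu_succ_t1,
        nu_succ_s0_hat, nu_succ_s0, nu_succ_t0, nu_succ_far, nu_one_12_hat, nu_one_12,
        nu_one_1_hat, nu_one_2_hat, nu_one_1, nu_one_2, nu_one_far, nu_one_far_hat,
        w, wHat, map_add, map_sub, map_smul, Nat.reduceSub]
      all_goals try
        simp only [Nat.reduceSub, Nat.cast_add, Nat.cast_one, Nat.cast_ofNat, zpow_add₀ hr,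
          zpow_sub₀ hr, zpow_natCast, zpow_ofNat, zpow_one]
      all_goals try (match_scalars <;> field_simp <;> ring)

/-- The quadratic expression `ν_k² + m ν_k - 1`. -/
noncomputable def quadOp {F : Type*} [Field F] (n : ℕ) (l r : F) (k : ℕ) :
    Module.End F (Space F n) :=
  nu n l r k ^ 2 + (r⁻¹ - r) • nu n l r k - 1

set_option maxHeartbeats 4000000 in
theorem quad_succ (hr : r ≠ 0) (hl : l ≠ 0) {j : ℕ} (hj : 1 ≤ j) (hjn : j + 1 ≤ n) (b : Bool)
    {s t : ℕ} (hs : 1 ≤ s) (hst : s < t) (ht : t ≤ n) :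
    quadOp n l r (j + 1) (wBar F n b s t) =
      (if s = j then if t = j + 1 then (if b then 0 else l⁻¹ ^ 2 + (r⁻¹ - r) * l⁻¹ - 1)
            else (r⁻¹ - r) * r ^ ((t : ℤ) - j - 2) * (if b then (r * l)⁻¹ else 1)
        else if s = j + 1 then
          (r⁻¹ - r) * r ^ ((t : ℤ) - j - 2) * (if b then (r * l)⁻¹ else 1) * l⁻¹
        else if t = j then (r⁻¹ - r) * l⁻¹ * r ^ ((s : ℤ) - j + 1)
        else if t = j + 1 then (r⁻¹ - r) * l⁻¹ * r ^ ((s : ℤ) - j + 1) * l⁻¹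
        else 0) • w F n j (j + 1) := by
  simp only [quadOp, pow_two, LinearMap.sub_apply, LinearMap.add_apply, LinearMap.smul_apply,
    Module.End.mul_apply, Module.End.one_apply]
  have key : ∀ x : ℕ, x = j ∨ x = j + 1 ∨ (x ≠ j ∧ x ≠ j + 1) := by omega
  rcases key s with rfl | rfl | h1 <;> rcases key t with rfl | rfl | h2 <;>
  first
  | omega
  | cases b <;>
    · simp (disch := omega) only [nu_succ_diag_hat, nu_succ_diag, nu_succ_s1, nu_succ_t1,
        nu_succ_s0_hat, nu_succ_s0, nu_succ_t0, nu_succ_far, w, map_add, map_sub, map_smul,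
        Nat.add_sub_cancel]
      simp only [*, if_true, if_false, Nat.cast_add, Nat.cast_one, Nat.cast_ofNat,
          zpow_add₀ hr, zpow_sub₀ hr, zpow_natCast, zpow_ofNat, zpow_one, ne_eq,
          Nat.succ_ne_self, Nat.left_eq_add, Nat.add_eq_left, one_ne_zero, not_false_eq_true, Bool.false_eq_true]
      all_goals try (match_scalars <;> field_simp <;> ring)

set_option maxHeartbeats 4000000 in
theorem quad_one (hr : r ≠ 0) (hl : l ≠ 0) (hn : 2 ≤ n) (b : Bool)
    {s t : ℕ} (hs : 1 ≤ s) (hst : s < t) (ht : t ≤ n) :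
    quadOp n l r 1 (wBar F n b s t) =
      (if s = 1 then if t = 2 then (if b then l⁻¹ ^ 2 + (r⁻¹ - r) * l⁻¹ - 1 else 0)
            else (r⁻¹ - r) * r ^ ((t : ℤ) - 3) * (if b then 1 else (r * l)⁻¹)
        else if s = 2 then
          (r⁻¹ - r) * r ^ ((t : ℤ) - 3) * (if b then r else l⁻¹)
        else if b then (r⁻¹ - r) ^ 2 * (r ^ ((s : ℤ) + t - 8) + r ^ ((s : ℤ) + t - 6)) * (l⁻¹ - r)
        else 0) • wHat F n 1 2 := by
  simp only [quadOp, pow_two, LinearMap.sub_apply, LinearMap.add_apply, LinearMap.smul_apply,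
    Module.End.mul_apply, Module.End.one_apply]
  have key : ∀ x : ℕ, 1 ≤ x → x = 1 ∨ x = 2 ∨ (3 ≤ x ∧ x ≠ 1 ∧ x ≠ 2) := by omega
  rcases key s hs with rfl | rfl | h1 <;> rcases key t (by omega) with rfl | rfl | h2 <;>
  first
  | omega
  | cases b <;>
    · simp (disch := omega) only [nu_one_12_hat, nu_one_12,
        nu_one_1_hat, nu_one_2_hat, nu_one_1, nu_one_2, nu_one_far, nu_one_far_hat,
        w, wHat, map_add, map_sub, map_smul]
      simp only [*, if_true, if_false, Nat.cast_add, Nat.cast_one, Nat.cast_ofNat,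
          zpow_add₀ hr, zpow_sub₀ hr, zpow_natCast, zpow_ofNat, zpow_one, ne_eq,
          not_false_eq_true, Bool.false_eq_true, OfNat.ofNat_ne_one]
      all_goals try (match_scalars <;> field_simp <;> ring)

/-- The basis vector indexed by the simple root of the node `k`. -/
noncomputable def rootVec (F : Type*) [Field F] (n k : ℕ) : Space F n :=
  if k = 1 then wHat F n 1 2 else w F n (k - 1) k

theorem quad_mem (hr : r ≠ 0) (hl : l ≠ 0) (hn : 2 ≤ n) {k : ℕ} (hk : 1 ≤ k) (hkn : k ≤ n)
    (x : Space F n) : quadOp n l r k x ∈ Submodule.span F {rootVec F n k} := by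
  induction x using Finsupp.induction_linear with
  | zero => simp
  | add x y hx hy => rw [map_add]; exact add_mem hx hy
  | single p c =>
    obtain ⟨⟨b, s, t⟩, hp⟩ := p
    have hp' : 1 ≤ s ∧ s < t ∧ t ≤ n := hp
    have : (Finsupp.single ⟨(b, s, t), hp⟩ c : Space F n) = c • wBar F n b s t := by
      simp [wBar, hp']
    rw [this, map_smul]
    refine Submodule.smul_mem _ _ ?_
    obtain rfl | hk' : k = 1 ∨ 2 ≤ k := by omega
    · rw [quad_one hr hl hn b hp'.1 hp'.2.1 hp'.2.2]
      exact Submodule.smul_mem _ _ (Submodule.subset_span (by simp [rootVec]))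
    · obtain ⟨j, rfl⟩ : ∃ j, k = j + 1 := ⟨k - 1, by omega⟩
      rw [quad_succ hr hl (by omega) hkn b hp'.1 hp'.2.1 hp'.2.2]
      have : j ≠ 0 := by omega
      exact Submodule.smul_mem _ _ (Submodule.subset_span (by simp [rootVec, this]))

theorem nu_rootVec (hn : 2 ≤ n) {k : ℕ} (hk : 1 ≤ k) (hkn : k ≤ n) :
    nu n l r k (rootVec F n k) = l⁻¹ • rootVec F n k := by
  obtain rfl | hk' : k = 1 ∨ 2 ≤ k := by omega
  · simp [rootVec, nu_one_12_hat hn]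
  · have : k ≠ 1 := by omega
    simp [rootVec, this, nu_succ_diag hk' (show k - 1 + 1 = k by omega) rfl hkn]

theorem nu_mul_quad (hr : r ≠ 0) (hl : l ≠ 0) (hn : 2 ≤ n) {k : ℕ} (hk : 1 ≤ k) (hkn : k ≤ n) :
    nu n l r k * quadOp n l r k = l⁻¹ • quadOp n l r k := by
  refine LinearMap.ext fun x => ?_
  obtain ⟨c, hc⟩ := Submodule.mem_span_singleton.1
    (quad_mem (l := l) (r := r) hr hl hn hk hkn x)
  simp only [Module.End.mul_apply, LinearMap.smul_apply]
  rw [← hc, map_smul, nu_rootVec hn hk hkn, smul_comm]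

theorem quad_nu_rootVec (hr : r ≠ 0) (hl : l ≠ 0) (hn : 2 ≤ n) {i j : ℕ} (hi : 1 ≤ i)
    (hin : i ≤ n) (hj : 1 ≤ j) (hjn : j ≤ n) (h : Adj i j) :
    quadOp n l r i (nu n l r j (rootVec F n i)) = (r⁻¹ - r) • rootVec F n i := by
  rcases h with ⟨rfl, rfl⟩ | ⟨rfl, rfl⟩ | ⟨h1, rfl⟩ | ⟨h1, rfl⟩
  · simp only [rootVec, if_true, wHat]
    rw [nu_succ_t1 (by omega) (by omega) (by omega) rfl (by omega),
      quad_one hr hl hn _ (by omega) (by omega) (by omega)]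
    simp
  · have q := fun b s t => quad_succ (n := n) (l := l) hr hl (j := 2) (by omega) hin b (s := s)
      (t := t)
    simp only [Nat.reduceAdd] at q
    simp only [rootVec, OfNat.ofNat_ne_one, if_false, w, Nat.reduceSub]
    rw [nu_one_2 (by omega) (by omega)]
    simp (disch := omega) only [map_add, map_sub, map_smul, q, wHat, w]
    simp only [OfNat.one_ne_ofNat, if_false, if_true, OfNat.ofNat_ne_one,
      Nat.reduceEqDiff, Bool.false_eq_true, Nat.cast_ofNat, Nat.cast_one]
    match_scalars <;> norm_num [zpow_ofNat] <;> field_simp <;> ring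
  · obtain ⟨k, rfl⟩ : ∃ k, i = k + 1 := ⟨i - 1, by omega⟩
    have : k ≠ 0 := by omega
    simp only [rootVec, Nat.add_eq_right, this, if_false, w, Nat.add_sub_cancel]
    rw [nu_succ_t1 (by omega) (by omega) (by omega) rfl (by omega),
      quad_succ hr hl (by omega) hin _ (by omega) (by omega) (by omega)]
    have e1 : k + 1 + 1 ≠ k + 1 := by omega
    have e2 : ((k : ℤ) + 1 + 1 - k - 2) = 0 := by ring
    simp [e1, e2]
  · obtain ⟨k, rfl⟩ : ∃ k, j = k + 1 := ⟨j - 1, by omega⟩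
    have : k ≠ 0 := by omega
    have e1 : ((k + 1 + 1 : ℕ) : ℤ) - (k + 1 : ℕ) - 1 = 0 := by push_cast; ring
    have q := fun b s t => quad_succ (n := n) (l := l) hr hl (j := k + 1) (by omega) hin b (s := s)
      (t := t)
    simp only [rootVec, Nat.add_eq_right, Nat.succ_ne_zero, if_false, w, Nat.add_sub_cancel]
    rw [nu_succ_s0 (by omega) (by omega) rfl (by omega)]
    simp (disch := omega) only [map_add, map_sub, map_smul, q, wHat, w, Nat.add_sub_cancel]
    have e2 : k ≠ k + 1 := by omega
    have e3 : k ≠ k + 1 + 1 := by omega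
    have e4 : k + 1 ≠ k + 1 + 1 := by omega
    have e5 : ((k : ℤ) - (k + 1 : ℕ) + 1) = 0 := by push_cast; ring
    have e6 : k + 1 + 1 ≠ k + 1 := by omega
    simp only [e1, e2, e3, e4, e5, e6, if_false, if_true, Bool.false_eq_true, zpow_zero]
    match_scalars <;> field_simp <;> ring

theorem quad_nu_quad (hr : r ≠ 0) (hl : l ≠ 0) (hn : 2 ≤ n) {i j : ℕ} (hi : 1 ≤ i)
    (hin : i ≤ n) (hj : 1 ≤ j) (hjn : j ≤ n) (h : Adj i j) :
    quadOp n l r i * nu n l r j * quadOp n l r i = (r⁻¹ - r) • quadOp n l r i := by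
  refine LinearMap.ext fun x => ?_
  obtain ⟨c, hc⟩ := Submodule.mem_span_singleton.1
    (quad_mem (l := l) (r := r) hr hl hn hi hin x)
  simp only [Module.End.mul_apply, LinearMap.smul_apply]
  rw [← hc, map_smul, map_smul, quad_nu_rootVec hr hl hn hi hin hj hjn h, smul_comm]

theorem nu_braid (hr : r ≠ 0) (hl : l ≠ 0) {i j : ℕ} (hi : 1 ≤ i)
    (hin : i ≤ n) (hj : 1 ≤ j) (hjn : j ≤ n) (h : Adj i j) :
    nu n l r i * nu n l r j * nu n l r i = nu n l r j * nu n l r i * nu n l r j := by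
  rcases h with ⟨rfl, rfl⟩ | ⟨rfl, rfl⟩ | ⟨h1, rfl⟩ | ⟨h1, rfl⟩
  · exact braid_one_three hr hl hjn
  · exact (braid_one_three hr hl hin).symm
  · obtain ⟨k, rfl⟩ : ∃ k, i = k + 1 := ⟨i - 1, by omega⟩
    exact braid_succ hr hl (by omega) hjn
  · obtain ⟨k, rfl⟩ : ∃ k, j = k + 1 := ⟨j - 1, by omega⟩
    exact (braid_succ hr hl (by omega) hin).symm

theorem nu_comm (hr : r ≠ 0) (hl : l ≠ 0) {i j : ℕ} (hi : 1 ≤ i)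
    (hin : i ≤ n) (hj : 1 ≤ j) (hjn : j ≤ n) (h : ¬ Adj i j) :
    nu n l r i * nu n l r j = nu n l r j * nu n l r i := by
  wlog hij : i ≤ j generalizing i j
  · exact (this hj hjn hi hin (by unfold Adj at *; omega) (by omega)).symm
  obtain rfl | hlt := hij.eq_or_lt
  · rfl
  unfold Adj at h
  obtain ⟨k, rfl⟩ : ∃ k, j = k + 1 := ⟨j - 1, by omega⟩
  obtain rfl | hi' : i = 1 ∨ 2 ≤ i := by omega
  · obtain rfl | hk : k = 1 ∨ 3 ≤ k := by omega
    · exact comm_one_two hr hl hjn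
    · exact comm_one hr hl hk hjn
  · obtain ⟨p, rfl⟩ : ∃ p, i = p + 1 := ⟨i - 1, by omega⟩
    exact comm_succ hr hl (by omega) (by omega) hjn

/-- The images of the generators under the Cohen-Wales representation: `g_k ↦ ν_k` and, as
forced by `m e_k = l (g_k² + m g_k - 1)`, `e_k ↦ (l / m) (ν_k² + m ν_k - 1)`; `m = r⁻¹ - r`. -/
noncomputable def repGen {F : Type*} [Field F] (n : ℕ) (l r : F) :
    Gen n → Module.End F (Space F n)
  | Gen.g k => nu n l r k
  | Gen.e k => (l / (r⁻¹ - r)) • (nu n l r k ^ 2 + (r⁻¹ - r) • nu n l r k - 1)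

theorem sub_ne (hr : r ≠ 0) (hr2 : r ^ 2 ≠ 1) : r⁻¹ - r ≠ 0 := by
  intro h
  apply hr2
  field_simp at h
  linear_combination -h

theorem repGen_rel (hr : r ≠ 0) (hr2 : r ^ 2 ≠ 1) (hl : l ≠ 0) (hn : 2 ≤ n)
    ⦃x y : FreeAlgebra F (Gen n)⦄ (h : Rel F n l (r⁻¹ - r) x y) :
    FreeAlgebra.lift F (repGen n l r) x = FreeAlgebra.lift F (repGen n l r) y := by
  have hm := sub_ne hr hr2
  have hE : ∀ k, repGen n l r (Gen.e k) = (l / (r⁻¹ - r)) • quadOp n l r k := fun _ => rfl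
  have hG : ∀ k, repGen n l r (Gen.g k) = nu n l r k := fun _ => rfl
  cases h with
  | braid i j h =>
    simpa [hG] using nu_braid hr hl i.2.1 i.2.2 j.2.1 j.2.2 h
  | comm i j h =>
    simpa [hG] using nu_comm hr hl i.2.1 i.2.2 j.2.1 j.2.2 h
  | quad i =>
    simp only [map_smul, map_sub, map_add, map_pow, map_one, FreeAlgebra.lift_ι_apply, hE, hG]
    rw [smul_smul, mul_div_cancel₀ _ hm]
    rfl
  | deloop i =>
    simp only [map_smul, map_mul, FreeAlgebra.lift_ι_apply, hE, hG]
    rw [mul_smul_comm, nu_mul_quad hr hl hn i.2.1 i.2.2, smul_comm]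
  | ege i j h =>
    simp only [map_smul, map_mul, FreeAlgebra.lift_ι_apply, hE, hG]
    rw [mul_smul_comm, smul_mul_assoc, smul_mul_assoc,
      quad_nu_quad hr hl hn i.2.1 i.2.2 j.2.1 j.2.2 h]
    simp only [smul_smul]
    congr 1
    field_simp

/-- The Cohen-Wales representation `ν^{(n)}` of the CGW algebra of type `D_n` with parameters
`l` and `m = r⁻¹ - r`, given on generators by `g_k ↦ ν_k`. -/
noncomputable def rep {F : Type*} [Field F] {n : ℕ} {l r : F} (hn : 4 ≤ n) (hr : r ≠ 0)
    (hr2 : r ^ 2 ≠ 1) (hl : l ≠ 0) : CGW F n l (r⁻¹ - r) →ₐ[F] Module.End F (Space F n) :=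
  RingQuot.liftAlgHom F ⟨FreeAlgebra.lift F (repGen n l r), repGen_rel hr hr2 hl (by omega)⟩

theorem rep_g (hn : 4 ≤ n) (hr : r ≠ 0) (hr2 : r ^ 2 ≠ 1) (hl : l ≠ 0) {k : ℕ} (hk : 1 ≤ k)
    (hkn : k ≤ n) : rep hn hr hr2 hl (g F n l (r⁻¹ - r) k) = nu n l r k := by
  simp [rep, g, hk, hkn, repGen]

theorem rep_e (hn : 4 ≤ n) (hr : r ≠ 0) (hr2 : r ^ 2 ≠ 1) (hl : l ≠ 0) {k : ℕ} (hk : 1 ≤ k)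
    (hkn : k ≤ n) : rep hn hr hr2 hl (e F n l (r⁻¹ - r) k) =
      (l / (r⁻¹ - r)) • (nu n l r k ^ 2 + (r⁻¹ - r) • nu n l r k - 1) := by
  simp [rep, e, hk, hkn, repGen]

end Rep

/-- A representation of an algebra is reducible if it has an invariant subspace other than `0`
and the whole space. -/
def IsReducible {F A V : Type*} [Field F] [Ring A] [Algebra F A] [AddCommGroup V] [Module F V]
    (ρ : A →ₐ[F] Module.End F V) : Prop :=
  ∃ W : Submodule F V, (∀ a : A, ∀ x ∈ W, ρ a x ∈ W) ∧ W ≠ ⊥ ∧ W ≠ ⊤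

/-- `K(n)`, the common kernel of the operators by which all the `C_{ij}` and `Ĉ_{ij}` with
`1 ≤ i < j ≤ n` act in the representation `ρ` (to be applied to `ρ = ν^{(n)}`). -/
noncomputable def K {F : Type*} [Field F] {n : ℕ} {l m : F}
    (ρ : CGW F n l m →ₐ[F] Module.End F (Space F n)) : Submodule F (Space F n) :=
  (⨅ (i : ℕ) (j : ℕ) (_ : 1 ≤ i ∧ i < j ∧ j ≤ n), LinearMap.ker (ρ (C F n l m i j))) ⊓
    (⨅ (i : ℕ) (j : ℕ) (_ : 1 ≤ i ∧ i < j ∧ j ≤ n), LinearMap.ker (ρ (CHat F n l m i j)))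

/-- The vector `X`. -/
noncomputable def vecX {F : Type*} [Field F] (n : ℕ) (r : F) : Space F n :=
  (w F n 2 4 + r ^ 2 • wHat F n 2 4) - r • (w F n 1 4 + r ^ 2 • wHat F n 1 4)
    - r • (w F n 2 3 + r ^ 2 • wHat F n 2 3) + r ^ 2 • (w F n 1 3 + r ^ 2 • wHat F n 1 3)

/-- The vector `Y`. -/
noncomputable def vecY {F : Type*} [Field F] (n : ℕ) (r : F) : Space F n :=
  w F n 3 4 - (1 / r) • w F n 3 5 + (1 / r ^ 2) • w F n 4 5

/-- The vector `Z`. -/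
noncomputable def vecZ {F : Type*} [Field F] (n : ℕ) (r : F) : Space F n :=
  r ^ 3 • wHat F n 2 4 - r ^ 2 • wHat F n 3 4 + w F n 2 3

/-- The vector `J_n`. -/
noncomputable def vecJ {F : Type*} [Field F] (n : ℕ) (r : F) : Space F n :=
  (wHat F n 1 2 + r ^ (2 * (n : ℤ) - 6) • w F n 1 2)
    - (1 / r) • (wHat F n 1 3 + r ^ (2 * (n : ℤ) - 6) • w F n 1 3)
    - (1 + r ^ (2 * (n : ℤ) - 6)) • w F n 2 3
    + r • ∑ j ∈ Finset.Icc 4 n, r ^ ((j : ℤ) - 5) •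
      ((w F n 3 j - wHat F n 3 j) - r • (w F n 2 j - wHat F n 2 j))

end CohenWales

namespace CohenWales

/-! ### Operator identities for an element satisfying the quadratic relation -/

section Operators

/-! The operator ν_k² + m ν_k - 1 has rank at most one: it sends x to φ_k(x) times the basis vector
of the simple root of node k (`quadOp_apply`). The generator e_k acts by a nonzero multiple of it,
and C_{ij}, Ĉ_{ij} arise from e_{i+1}, e_1 by multiplying by units on both sides. Hence the kernel
of each is the kernel of a single linear form, namely φ_{i+1} ν_{i+2}⁻¹ ⋯ ν_j⁻¹ for C_{ij} and φ_1
ν_3⁻¹ ⋯ ν_j⁻¹ ν_2⁻¹ ⋯ ν_i⁻¹ for Ĉ_{ij}, and K(n) is the set of common zeros of these forms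
(`mem_K_iff`).

So K(n) is a submodule as soon as the span of the forms is stable under composition with every ν_k
on the right (`fullSpan_comp_nu`). Because ν_k⁻¹ = ν_k + m - l (ν_k² + m ν_k - 1) and φ_k is one of
the forms, one is free to compose with ν_k or with ν_k⁻¹, whichever is easier
(`comp_nuInv_mem_iff`). The identities φ_i ν_j = r φ_i for distinct non-adjacent nodes and φ_i ν_j
ν_i = φ_j for adjacent ones, combined with the braid relations, show that nodes 2, …, n either scale
a form by a constant or move it to a neighbouring one, up to that freedom. Node 1 exchanges the two
families; there the smaller span of the C_{ij}-forms serves as an intermediate step.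

For the explicit vectors one needs the values of all the forms on the basis. They are given in
closed form by `gram` and `gramHat` and proved by recursion on the string of inverses (`form_wBar`,
`formHat_wBar`). For X, Y, Z the claim is then a finite check, according to the position of i and j
relative to the few indices in the support. The vector J_n has support growing with n, but it is an
eigenvector of ν_k with eigenvalue r for k ≥ 5 (`nu_vecJ`). Trailing factors ν_k⁻¹ with k ≥ 5 can
therefore be dropped, which leaves the forms with j ≤ 4 and the one of Ĉ_{45}; on these the sum in
J_n telescopes.

Finally K(n) is never the whole space, since e_2 does not annihilate w_{13}. A nonzero vector in
K(n) thus gives reducibility. -/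

theorem hecke_mul_comm {A F : Type*} [Field F] [Ring A] [Algebra F A] {g q : A} {m c : F}
    (hq : q = g ^ 2 + m • g - 1) (h : g * q = c • q) : q * g = c • q := by
  rw [← h, hq]
  simp only [sub_mul, mul_sub, add_mul, mul_add, smul_mul_assoc, mul_smul_comm, one_mul,
    mul_one, ← pow_succ, ← pow_succ']

theorem hecke_mul_inv {A F : Type*} [Field F] [Ring A] [Algebra F A] {g q : A} {m l : F}
    (hl : l ≠ 0) (hq : q = g ^ 2 + m • g - 1) (h : g * q = l⁻¹ • q) :
    g * (g + m • (1 : A) - l • q) = 1 := by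
  rw [mul_sub, mul_smul_comm, h, smul_inv_smul₀ hl, hq, mul_add, mul_smul_comm, mul_one, pow_two]
  abel

theorem hecke_inv_mul {A F : Type*} [Field F] [Ring A] [Algebra F A] {g q : A} {m l : F}
    (hl : l ≠ 0) (hq : q = g ^ 2 + m • g - 1) (h : g * q = l⁻¹ • q) :
    (g + m • (1 : A) - l • q) * g = 1 := by
  rw [sub_mul, smul_mul_assoc, hecke_mul_comm hq h, smul_inv_smul₀ hl, hq, add_mul,
    smul_mul_assoc, one_mul, pow_two]
  abel

/-- Used with x = ν_j and g = g' = ν_i for non-adjacent nodes, and with x = ν_j ν_i, which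
conjugates ν_j into ν_i, for adjacent ones. -/
theorem semiconjBy_hecke {A F : Type*} [Field F] [Ring A] [Algebra F A] {x g g' : A} {m : F}
    (h : SemiconjBy x g g') :
    SemiconjBy x (g ^ 2 + m • g - 1) (g' ^ 2 + m • g' - 1) := by
  refine ((h.pow_right 2).add_right ?_).sub_right (SemiconjBy.one_right _)
  rw [SemiconjBy, mul_smul_comm, h.eq, smul_mul_assoc]

/-- Multiply the braid relation by x⁻¹ y⁻¹ on both sides. -/
theorem inv_inv_mul_of_braid {M : Type*} [Monoid M] {x y x' y' : M} (hx : x' * x = 1)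
    (hx' : x * x' = 1) (hy : y' * y = 1) (hy' : y * y' = 1) (h : x * y * x = y * x * y) :
    x' * y' * x = y * x' * y' := by
  let u : Mˣ := ⟨x, x', hx', hx⟩
  let v : Mˣ := ⟨y, y', hy', hy⟩
  have hu : u * v * u = v * u * v := Units.ext h
  have : u⁻¹ * v⁻¹ * u = v * u⁻¹ * v⁻¹ := by
    simpa [mul_assoc] using congrArg (fun z => u⁻¹ * v⁻¹ * z * u⁻¹ * v⁻¹) hu
  exact congrArg Units.val this

theorem commute_of_inv {M : Type*} [Monoid M] {x y x' : M} (hx : x' * x = 1) (hx' : x * x' = 1)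
    (h : Commute x y) : Commute x' y :=
  Commute.units_inv_left (u := ⟨x, x', hx', hx⟩) h

theorem comp_comp_comp_congr {F V : Type*} [Field F] [AddCommMonoid V] [Module F V]
    {a b c a' b' c' : Module.End F V} (h : a * b * c = a' * b' * c') (f : Module.Dual F V) :
    ((f ∘ₗ a) ∘ₗ b) ∘ₗ c = ((f ∘ₗ a') ∘ₗ b') ∘ₗ c' := by
  rw [LinearMap.comp_assoc, LinearMap.comp_assoc, LinearMap.comp_assoc, LinearMap.comp_assoc,
    ← Module.End.mul_eq_comp, ← Module.End.mul_eq_comp, ← Module.End.mul_eq_comp,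
    ← Module.End.mul_eq_comp, ← mul_assoc, ← mul_assoc, h]

theorem comp_comp_congr {F V : Type*} [Field F] [AddCommMonoid V] [Module F V]
    {a b a' b' : Module.End F V} (h : a * b = a' * b') (f : Module.Dual F V) :
    (f ∘ₗ a) ∘ₗ b = (f ∘ₗ a') ∘ₗ b' := by
  rw [LinearMap.comp_assoc, LinearMap.comp_assoc, ← Module.End.mul_eq_comp,
    ← Module.End.mul_eq_comp, h]

end Operators

/-! ### The linear forms attached to the C_{ij} and Ĉ_{ij}, and stability of their span -/

section Functionals

variable {F : Type*} [Field F] {n : ℕ} {l r : F}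

/-- The inverse `ν_k + m - l (ν_k² + m ν_k - 1)` of `ν_k`. -/
noncomputable def nuInv {F : Type*} [Field F] (n : ℕ) (l r : F) (k : ℕ) :
    Module.End F (Space F n) :=
  nu n l r k + (r⁻¹ - r) • 1 - l • quadOp n l r k

theorem quad_mul_nu (hr : r ≠ 0) (hl : l ≠ 0) (hn : 2 ≤ n) {k : ℕ} (hk : 1 ≤ k) (hkn : k ≤ n) :
    quadOp n l r k * nu n l r k = l⁻¹ • quadOp n l r k :=
  hecke_mul_comm (A := Module.End F (Space F n)) (m := r⁻¹ - r) rfl (nu_mul_quad hr hl hn hk hkn)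

theorem nu_mul_nuInv (hr : r ≠ 0) (hl : l ≠ 0) (hn : 2 ≤ n) {k : ℕ} (hk : 1 ≤ k) (hkn : k ≤ n) :
    nu n l r k * nuInv n l r k = 1 :=
  hecke_mul_inv (A := Module.End F (Space F n)) (m := r⁻¹ - r) hl rfl (nu_mul_quad hr hl hn hk hkn)

theorem nuInv_mul_nu (hr : r ≠ 0) (hl : l ≠ 0) (hn : 2 ≤ n) {k : ℕ} (hk : 1 ≤ k) (hkn : k ≤ n) :
    nuInv n l r k * nu n l r k = 1 :=
  hecke_inv_mul (A := Module.End F (Space F n)) (m := r⁻¹ - r) hl rfl (nu_mul_quad hr hl hn hk hkn)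

/-- The coefficient of the basis vector `w_{st}` or `ŵ_{st}`. -/
noncomputable def coord (F : Type*) [Field F] (n : ℕ) (b : Bool) (s t : ℕ) :
    Module.Dual F (Space F n) :=
  Finsupp.linearCombination F fun p : PosRoot n => if p.1 = (b, s, t) then 1 else 0

theorem coord_self (b : Bool) {s t : ℕ} (hs : 1 ≤ s) (hst : s < t) (ht : t ≤ n) :
    coord F n b s t (wBar F n b s t) = 1 := by
  simp [coord, wBar, hs, hst, ht]

theorem coord_of_ne (b b' : Bool) {s t s' t' : ℕ} (h : (b', s', t') ≠ (b, s, t)) :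
    coord F n b s t (wBar F n b' s' t') = 0 := by
  unfold wBar
  split_ifs
  · simp only [coord, Finsupp.linearCombination_single, h, if_false, smul_zero]
  · simp

/-- The linear form `φ_k` with `ν_k² + m ν_k - 1 = φ_k(·) • rootVec k`. -/
noncomputable def phi {F : Type*} [Field F] (n : ℕ) (l r : F) (k : ℕ) :
    Module.Dual F (Space F n) :=
  (if k = 1 then coord F n true 1 2 else coord F n false (k - 1) k) ∘ₗ quadOp n l r k

theorem quadOp_apply (hr : r ≠ 0) (hl : l ≠ 0) (hn : 2 ≤ n) {k : ℕ} (hk : 1 ≤ k) (hkn : k ≤ n)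
    (x : Space F n) : quadOp n l r k x = phi n l r k x • rootVec F n k := by
  obtain ⟨c, hc⟩ := Submodule.mem_span_singleton.1
    (quad_mem (l := l) (r := r) hr hl hn hk hkn x)
  rw [phi, LinearMap.comp_apply, ← hc, map_smul]
  obtain rfl | hk' : k = 1 ∨ 2 ≤ k := by omega
  · simp [rootVec, coord_self true le_rfl (by omega : 1 < 2) hn]
  · have : k ≠ 1 := by omega
    simp [rootVec, this, coord_self false (by omega : 1 ≤ k - 1) (by omega : k - 1 < k) hkn]

theorem rootVec_ne_zero (hn : 2 ≤ n) {k : ℕ} (hk : 1 ≤ k) (hkn : k ≤ n) :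
    rootVec F n k ≠ 0 := by
  obtain rfl | hk' : k = 1 ∨ 2 ≤ k := by omega
  · simp [rootVec, wBar, hn]
  · have : k ≠ 1 := by omega
    have h2 : 1 ≤ k - 1 ∧ k - 1 < k := by omega
    simp [rootVec, wBar, this, h2, hkn]

/-- Lets identities between the forms φ_k be proved as operator identities, the root vector being
nonzero. -/
theorem phi_eq_of_quadOp (hr : r ≠ 0) (hl : l ≠ 0) (hn : 2 ≤ n) {k : ℕ} (hk : 1 ≤ k) (hkn : k ≤ n)
    {x : Space F n} {c : F} (h : quadOp n l r k x = c • rootVec F n k) : phi n l r k x = c := by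
  rw [quadOp_apply hr hl hn hk hkn] at h
  exact smul_left_injective F (rootVec_ne_zero hn hk hkn) h

theorem phi_comp_nu_self (hr : r ≠ 0) (hl : l ≠ 0) (hn : 2 ≤ n) {k : ℕ} (hk : 1 ≤ k)
    (hkn : k ≤ n) : phi n l r k ∘ₗ nu n l r k = l⁻¹ • phi n l r k := by
  refine LinearMap.ext fun x => phi_eq_of_quadOp hr hl hn hk hkn ?_
  rw [← Module.End.mul_apply, quad_mul_nu hr hl hn hk hkn]
  simp [quadOp_apply hr hl hn hk hkn, smul_smul]

theorem nu_rootVec_of_not_adj (hn : 2 ≤ n) {i j : ℕ} (hi : 1 ≤ i) (hin : i ≤ n) (hj : 1 ≤ j)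
    (hjn : j ≤ n) (h : ¬ Adj i j) (hij : i ≠ j) :
    nu n l r j (rootVec F n i) = r • rootVec F n i := by
  unfold Adj at h
  obtain rfl | hi' : i = 1 ∨ 2 ≤ i := by omega
  · obtain rfl | hj' : j = 2 ∨ 3 ≤ j := by omega
    · simp [rootVec, nu_succ_diag_hat (n := n) (l := l) (r := r) le_rfl rfl rfl hn]
    · simp only [rootVec, if_true]
      exact nu_succ_far (by omega) (by omega) (by omega) hn (by omega) (by omega) (by omega)
        (by omega)
  · have : i ≠ 1 := by omega
    simp only [rootVec, this, if_false]
    obtain rfl | hj' : j = 1 ∨ 2 ≤ j := by omega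
    · obtain rfl | hi2 : i = 2 ∨ 4 ≤ i := by omega
      · exact nu_one_12 hn
      · exact nu_one_far (by omega) (by omega) hin
    · exact nu_succ_far (by omega) (by omega) (by omega) hin (by omega) (by omega) (by omega)
        (by omega)

theorem quad_mul_nu_of_not_adj (hr : r ≠ 0) (hl : l ≠ 0) {i j : ℕ} (hi : 1 ≤ i)
    (hin : i ≤ n) (hj : 1 ≤ j) (hjn : j ≤ n) (h : ¬ Adj i j) :
    quadOp n l r i * nu n l r j = nu n l r j * quadOp n l r i := by
  have hs : SemiconjBy (nu n l r j) (nu n l r i) (nu n l r i) :=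
    (nu_comm hr hl hi hin hj hjn h).symm
  have hq : SemiconjBy (nu n l r j) (quadOp n l r i) (quadOp n l r i) :=
    semiconjBy_hecke (A := Module.End F (Space F n)) (m := r⁻¹ - r) hs
  exact hq.symm

/-- The quadratic operator of node i commutes with ν_j, and ν_j multiplies the root vector of i by
r. -/
theorem phi_comp_nu_of_not_adj (hr : r ≠ 0) (hl : l ≠ 0) (hn : 2 ≤ n) {i j : ℕ} (hi : 1 ≤ i)
    (hin : i ≤ n) (hj : 1 ≤ j) (hjn : j ≤ n) (h : ¬ Adj i j) (hij : i ≠ j) :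
    phi n l r i ∘ₗ nu n l r j = r • phi n l r i := by
  refine LinearMap.ext fun x => phi_eq_of_quadOp hr hl hn hi hin ?_
  rw [← Module.End.mul_apply, quad_mul_nu_of_not_adj hr hl hi hin hj hjn h, Module.End.mul_apply,
    quadOp_apply hr hl hn hi hin, map_smul, nu_rootVec_of_not_adj hn hi hin hj hjn h hij, smul_smul,
    mul_comm]
  rfl

theorem nu_nu_rootVec (hl : l ≠ 0) {i j : ℕ} (hi : 1 ≤ i)
    (hin : i ≤ n) (hj : 1 ≤ j) (hjn : j ≤ n) (h : Adj i j) :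
    nu n l r j (nu n l r i (rootVec F n j)) = rootVec F n i := by
  rcases h with ⟨rfl, rfl⟩ | ⟨rfl, rfl⟩ | ⟨h1, rfl⟩ | ⟨h1, rfl⟩
  · simp (disch := omega) only [rootVec, if_true, OfNat.ofNat_ne_one, if_false, Nat.reduceSub, w,
      wHat, nu_one_2, map_add, map_sub, map_smul, nu_succ_t0, nu_succ_t1, nu_succ_diag]
    match_scalars <;> norm_num
    all_goals field_simp
    ring
  · simp (disch := omega) only [rootVec, if_true, OfNat.ofNat_ne_one, if_false, Nat.reduceSub, w,
      wHat, nu_succ_t1, nu_one_1_hat]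
  · obtain ⟨k, rfl⟩ : ∃ k, i = k + 1 := ⟨i - 1, by omega⟩
    have e1 : k + 1 ≠ 1 := by omega
    have e2 : k + 1 + 1 ≠ 1 := by omega
    simp (disch := omega) only [rootVec, e1, e2, if_false, Nat.add_sub_cancel, w,
      nu_succ_s0, map_add, map_sub, map_smul, nu_succ_t0, nu_succ_t1, nu_succ_diag]
    have e3 : ((k + 1 + 1 : ℕ) : ℤ) - (k : ℤ) - 2 = 0 := by push_cast; ring
    have e4 : ((k + 1 + 1 : ℕ) : ℤ) - ((k + 1 : ℕ) : ℤ) - 1 = 0 := by push_cast; ring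
    simp only [e3, e4, zpow_zero]
    match_scalars <;> field_simp <;> ring
  · obtain ⟨k, rfl⟩ : ∃ k, j = k + 1 := ⟨j - 1, by omega⟩
    have e1 : k + 1 ≠ 1 := by omega
    have e2 : k + 1 + 1 ≠ 1 := by omega
    simp (disch := omega) only [rootVec, e1, e2, if_false, Nat.add_sub_cancel, w,
      nu_succ_t1, nu_succ_s1]

/-- By the braid relation ν_j ν_i intertwines ν_j with ν_i, hence also their quadratic operators,
and it carries the root vector of j to that of i. Comparing coefficients of the latter gives the
identity. -/
theorem phi_comp_nu_nu (hr : r ≠ 0) (hl : l ≠ 0) (hn : 2 ≤ n) {i j : ℕ} (hi : 1 ≤ i)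
    (hin : i ≤ n) (hj : 1 ≤ j) (hjn : j ≤ n) (h : Adj i j) :
    phi n l r i ∘ₗ nu n l r j ∘ₗ nu n l r i = phi n l r j := by
  have hs : SemiconjBy (nu n l r j * nu n l r i) (nu n l r j) (nu n l r i) := by
    have := nu_braid hr hl hi hin hj hjn h
    rw [SemiconjBy, ← mul_assoc, this, mul_assoc]
  have hq : SemiconjBy (nu n l r j * nu n l r i) (quadOp n l r j) (quadOp n l r i) :=
    semiconjBy_hecke (A := Module.End F (Space F n)) (m := r⁻¹ - r) hs
  refine LinearMap.ext fun x => phi_eq_of_quadOp hr hl hn hi hin ?_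
  have := LinearMap.congr_fun hq.eq x
  simp only [Module.End.mul_apply, quadOp_apply hr hl hn hj hjn, map_smul,
    nu_nu_rootVec hl hi hin hj hjn h] at this
  exact this.symm

theorem comp_nu_comp_nuInv (hr : r ≠ 0) (hl : l ≠ 0) (hn : 2 ≤ n) {k : ℕ} (hk : 1 ≤ k)
    (hkn : k ≤ n) (f : Module.Dual F (Space F n)) : (f ∘ₗ nu n l r k) ∘ₗ nuInv n l r k = f := by
  rw [LinearMap.comp_assoc, ← Module.End.mul_eq_comp, nu_mul_nuInv hr hl hn hk hkn]
  rfl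

theorem comp_nuInv_comp_nu (hr : r ≠ 0) (hl : l ≠ 0) (hn : 2 ≤ n) {k : ℕ} (hk : 1 ≤ k)
    (hkn : k ≤ n) (f : Module.Dual F (Space F n)) : (f ∘ₗ nuInv n l r k) ∘ₗ nu n l r k = f := by
  rw [LinearMap.comp_assoc, ← Module.End.mul_eq_comp, nuInv_mul_nu hr hl hn hk hkn]
  rfl

theorem eq_comp_nuInv (hr : r ≠ 0) (hl : l ≠ 0) (hn : 2 ≤ n) {k : ℕ} (hk : 1 ≤ k)
    (hkn : k ≤ n) {f f' : Module.Dual F (Space F n)} (h : f ∘ₗ nu n l r k = f') :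
    f = f' ∘ₗ nuInv n l r k := by
  rw [← h, comp_nu_comp_nuInv hr hl hn hk hkn]

theorem eq_comp_nu (hr : r ≠ 0) (hl : l ≠ 0) (hn : 2 ≤ n) {k : ℕ} (hk : 1 ≤ k)
    (hkn : k ≤ n) {f f' : Module.Dual F (Space F n)} (h : f ∘ₗ nuInv n l r k = f') :
    f = f' ∘ₗ nu n l r k := by
  rw [← h, comp_nuInv_comp_nu hr hl hn hk hkn]

theorem phi_comp_nuInv_adj (hr : r ≠ 0) (hl : l ≠ 0) (hn : 2 ≤ n) {i j : ℕ} (hi : 1 ≤ i)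
    (hin : i ≤ n) (hj : 1 ≤ j) (hjn : j ≤ n) (h : Adj i j) :
    phi n l r i ∘ₗ nu n l r j = phi n l r j ∘ₗ nuInv n l r i :=
  eq_comp_nuInv hr hl hn hi hin (by rw [LinearMap.comp_assoc, phi_comp_nu_nu hr hl hn hi hin hj hjn h])

theorem comp_nuInv (f : Module.Dual F (Space F n)) (hr : r ≠ 0) (hl : l ≠ 0) (hn : 2 ≤ n) {k : ℕ}
    (hk : 1 ≤ k) (hkn : k ≤ n) : f ∘ₗ nuInv n l r k =
      f ∘ₗ nu n l r k + (r⁻¹ - r) • f - (l * f (rootVec F n k)) • phi n l r k := by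
  refine LinearMap.ext fun x => ?_
  simp only [nuInv, LinearMap.comp_apply, LinearMap.sub_apply, LinearMap.add_apply,
    LinearMap.smul_apply, map_sub, map_add, map_smul, Module.End.one_apply,
    quadOp_apply hr hl hn hk hkn, smul_eq_mul]
  ring

/-- A space of linear forms containing `f` and `φ_k` contains `f ∘ ν_k` if and only if it contains
`f ∘ ν_k⁻¹`. -/
theorem comp_nuInv_mem_iff (hr : r ≠ 0) (hl : l ≠ 0) (hn : 2 ≤ n) {k : ℕ} (hk : 1 ≤ k)
    (hkn : k ≤ n) {W : Submodule F (Module.Dual F (Space F n))} {f : Module.Dual F (Space F n)}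
    (hf : f ∈ W) (hp : phi n l r k ∈ W) : f ∘ₗ nuInv n l r k ∈ W ↔ f ∘ₗ nu n l r k ∈ W := by
  rw [comp_nuInv f hr hl hn hk hkn,
    W.sub_mem_iff_left (W.smul_mem _ hp), W.add_mem_iff_left (W.smul_mem _ hf)]

theorem nuInv_comm_nu (hr : r ≠ 0) (hl : l ≠ 0) (hn : 2 ≤ n) {i j : ℕ} (hi : 1 ≤ i)
    (hin : i ≤ n) (hj : 1 ≤ j) (hjn : j ≤ n) (h : ¬ Adj i j) :
    Commute (nuInv n l r i) (nu n l r j) :=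
  commute_of_inv (nuInv_mul_nu hr hl hn hi hin) (nu_mul_nuInv hr hl hn hi hin)
    (nu_comm hr hl hi hin hj hjn h)

theorem nuInv_comm (hr : r ≠ 0) (hl : l ≠ 0) (hn : 2 ≤ n) {i j : ℕ} (hi : 1 ≤ i)
    (hin : i ≤ n) (hj : 1 ≤ j) (hjn : j ≤ n) (h : ¬ Adj i j) :
    Commute (nuInv n l r i) (nuInv n l r j) :=
  (commute_of_inv (nuInv_mul_nu hr hl hn hj hjn) (nu_mul_nuInv hr hl hn hj hjn)
    (nuInv_comm_nu hr hl hn hi hin hj hjn h).symm).symm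

theorem comp_nuInv_nu_comm (hr : r ≠ 0) (hl : l ≠ 0) (hn : 2 ≤ n) {i j : ℕ} (hi : 1 ≤ i)
    (hin : i ≤ n) (hj : 1 ≤ j) (hjn : j ≤ n) (h : ¬ Adj i j) (f : Module.Dual F (Space F n)) :
    (f ∘ₗ nuInv n l r i) ∘ₗ nu n l r j = (f ∘ₗ nu n l r j) ∘ₗ nuInv n l r i :=
  comp_comp_congr (nuInv_comm_nu hr hl hn hi hin hj hjn h).eq f

theorem comp_nuInv_nuInv_comm (hr : r ≠ 0) (hl : l ≠ 0) (hn : 2 ≤ n) {i j : ℕ} (hi : 1 ≤ i)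
    (hin : i ≤ n) (hj : 1 ≤ j) (hjn : j ≤ n) (h : ¬ Adj i j) (f : Module.Dual F (Space F n)) :
    (f ∘ₗ nuInv n l r i) ∘ₗ nuInv n l r j = (f ∘ₗ nuInv n l r j) ∘ₗ nuInv n l r i :=
  comp_comp_congr (nuInv_comm hr hl hn hi hin hj hjn h).eq f

theorem comp_nu_nu_comm (hr : r ≠ 0) (hl : l ≠ 0) {i j : ℕ} (hi : 1 ≤ i)
    (hin : i ≤ n) (hj : 1 ≤ j) (hjn : j ≤ n) (h : ¬ Adj i j) (f : Module.Dual F (Space F n)) :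
    (f ∘ₗ nu n l r i) ∘ₗ nu n l r j = (f ∘ₗ nu n l r j) ∘ₗ nu n l r i :=
  comp_comp_congr (nu_comm hr hl hi hin hj hjn h) f

/-- `f ν_i⁻¹ ν_j⁻¹ ν_i = f ν_j ν_i⁻¹ ν_j⁻¹` for adjacent `i`, `j`. -/
theorem comp_nuInv_nuInv_nu (hr : r ≠ 0) (hl : l ≠ 0) (hn : 2 ≤ n) {i j : ℕ} (hi : 1 ≤ i)
    (hin : i ≤ n) (hj : 1 ≤ j) (hjn : j ≤ n) (h : Adj i j) (f : Module.Dual F (Space F n)) :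
    ((f ∘ₗ nuInv n l r i) ∘ₗ nuInv n l r j) ∘ₗ nu n l r i =
      ((f ∘ₗ nu n l r j) ∘ₗ nuInv n l r i) ∘ₗ nuInv n l r j := by
  have e : nuInv n l r i * nuInv n l r j * nu n l r i =
      nu n l r j * nuInv n l r i * nuInv n l r j :=
    inv_inv_mul_of_braid (nuInv_mul_nu hr hl hn hi hin) (nu_mul_nuInv hr hl hn hi hin)
      (nuInv_mul_nu hr hl hn hj hjn) (nu_mul_nuInv hr hl hn hj hjn)
      (nu_braid hr hl hi hin hj hjn h)
  exact comp_comp_comp_congr e f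

/-- `f ν_i ν_j⁻¹ ν_i⁻¹ = f ν_j⁻¹ ν_i⁻¹ ν_j` for adjacent `i`, `j`. -/
theorem comp_nu_nuInv_nuInv (hr : r ≠ 0) (hl : l ≠ 0) (hn : 2 ≤ n) {i j : ℕ} (hi : 1 ≤ i)
    (hin : i ≤ n) (hj : 1 ≤ j) (hjn : j ≤ n) (h : Adj i j) (f : Module.Dual F (Space F n)) :
    ((f ∘ₗ nu n l r i) ∘ₗ nuInv n l r j) ∘ₗ nuInv n l r i =
      ((f ∘ₗ nuInv n l r j) ∘ₗ nuInv n l r i) ∘ₗ nu n l r j := by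
  have h' : Adj j i := by unfold Adj at *; omega
  rw [comp_nuInv_nuInv_nu hr hl hn hj hjn hi hin h']

/-- The linear form `φ_{i+1} ν_{i+2}⁻¹ ⋯ ν_{i+d+1}⁻¹` attached to `C_{i,i+d+1}`. -/
noncomputable def form {F : Type*} [Field F] (n : ℕ) (l r : F) (i : ℕ) :
    ℕ → Module.Dual F (Space F n)
  | 0 => phi n l r (i + 1)
  | d + 1 => form n l r i d ∘ₗ nuInv n l r (i + d + 2)

/-- The linear form `φ_1 ν_3⁻¹ ⋯ ν_{d+2}⁻¹` attached to `Ĉ_{1,d+2}`. -/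
noncomputable def formHatOne {F : Type*} [Field F] (n : ℕ) (l r : F) :
    ℕ → Module.Dual F (Space F n)
  | 0 => phi n l r 1
  | d + 1 => formHatOne n l r d ∘ₗ nuInv n l r (d + 3)

/-- The linear form `φ_1 ν_3⁻¹ ⋯ ν_{d+2}⁻¹ ν_2⁻¹ ⋯ ν_{e+1}⁻¹` attached to `Ĉ_{e+1,d+2}`. -/
noncomputable def formHat {F : Type*} [Field F] (n : ℕ) (l r : F) (d : ℕ) :
    ℕ → Module.Dual F (Space F n)
  | 0 => formHatOne n l r d
  | e + 1 => formHat n l r d e ∘ₗ nuInv n l r (e + 2)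

/-- The space of linear forms spanned by those attached to the `C_{ij}`. -/
noncomputable def formSpan {F : Type*} [Field F] (n : ℕ) (l r : F) :
    Submodule F (Module.Dual F (Space F n)) :=
  Submodule.span F {f | ∃ i d, 1 ≤ i ∧ i + d + 1 ≤ n ∧ f = form n l r i d}

/-- The space of linear forms spanned by those attached to the `C_{ij}` and the `Ĉ_{ij}`. -/
noncomputable def fullSpan {F : Type*} [Field F] (n : ℕ) (l r : F) :
    Submodule F (Module.Dual F (Space F n)) :=
  formSpan n l r ⊔ Submodule.span F {f | ∃ d e, e ≤ d ∧ d + 2 ≤ n ∧ f = formHat n l r d e}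

theorem form_mem {i d : ℕ} (hi : 1 ≤ i) (hd : i + d + 1 ≤ n) :
    form n l r i d ∈ formSpan n l r :=
  Submodule.subset_span ⟨i, d, hi, hd, rfl⟩

theorem form_mem_full {i d : ℕ} (hi : 1 ≤ i) (hd : i + d + 1 ≤ n) :
    form n l r i d ∈ fullSpan n l r :=
  Submodule.mem_sup_left (form_mem hi hd)

theorem formHat_mem {d e : ℕ} (he : e ≤ d) (hd : d + 2 ≤ n) :
    formHat n l r d e ∈ fullSpan n l r :=
  Submodule.mem_sup_right (Submodule.subset_span ⟨d, e, he, hd, rfl⟩)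

theorem phi_mem {k : ℕ} (hk : 2 ≤ k) (hkn : k ≤ n) : phi n l r k ∈ formSpan n l r := by
  obtain ⟨i, rfl⟩ : ∃ i, k = i + 1 := ⟨k - 1, by omega⟩
  exact form_mem (d := 0) (by omega) (by omega)

theorem phi_mem_full (hn : 2 ≤ n) {k : ℕ} (hk : 1 ≤ k) (hkn : k ≤ n) :
    phi n l r k ∈ fullSpan n l r := by
  obtain rfl | hk' : k = 1 ∨ 2 ≤ k := by omega
  · exact formHat_mem (d := 0) (e := 0) le_rfl (by omega)
  · exact Submodule.mem_sup_left (phi_mem hk' hkn)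

/-- Nodes away from the support of the root fix a form up to the factor `r`. -/
theorem form_comp_nu_far (hr : r ≠ 0) (hl : l ≠ 0) (hn : 2 ≤ n) {i d k : ℕ} (hi : 1 ≤ i)
    (hd : i + d + 1 ≤ n) (hk : 1 ≤ k) (hkn : k ≤ n)
    (h : ∀ t, i + 1 ≤ t → t ≤ i + d + 1 → ¬ Adj t k ∧ t ≠ k) :
    form n l r i d ∘ₗ nu n l r k = r • form n l r i d := by
  induction d with
  | zero =>
    obtain ⟨h1, h2⟩ := h (i + 1) (by omega) (by omega)
    exact phi_comp_nu_of_not_adj hr hl hn (by omega) (by omega) hk hkn h1 h2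
  | succ d ih =>
    obtain ⟨h1, -⟩ := h (i + d + 2) (by omega) (by omega)
    rw [form, comp_nuInv_nu_comm hr hl hn (by omega) (by omega) hk hkn h1,
      ih (by omega) (fun t h1 h2 => h t h1 (by omega)), LinearMap.smul_comp]

theorem form_succ_comp_nu_top (hr : r ≠ 0) (hl : l ≠ 0) (hn : 2 ≤ n) {i d : ℕ}
    (hd : i + d + 2 ≤ n) :
    form n l r i (d + 1) ∘ₗ nu n l r (i + d + 2) = form n l r i d := by
  rw [form, comp_nuInv_comp_nu hr hl hn (by omega) hd]

theorem form_comp_nu_interior (hr : r ≠ 0) (hl : l ≠ 0) (hn : 2 ≤ n) {i d k : ℕ} (hi : 1 ≤ i)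
    (hd : i + d + 1 ≤ n) (hk : i + 2 ≤ k) (hkd : k ≤ i + d) :
    form n l r i d ∘ₗ nu n l r k = r • form n l r i d := by
  obtain ⟨c, rfl⟩ : ∃ c, d = c + (k - i) := ⟨d - (k - i), by omega⟩
  induction c with
  | zero =>
    obtain ⟨d, rfl⟩ : ∃ d, k = i + d + 2 := ⟨k - i - 2, by omega⟩
    have e : 0 + (i + d + 2 - i) = d + 1 + 1 := by omega
    -- With k = i + d + 2, the braid relation turns the trailing ν_k⁻¹ ν_{k+1}⁻¹ ν_k into ν_{k+1}
    -- ν_k⁻¹ ν_{k+1}⁻¹. Now ν_{k+1} meets only a form built from the nodes i+1, …, k-1, which it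
    -- multiplies by r. The inductive step on c adds further inverses, all commuting with ν_k.
    rw [e, form, form, show i + (d + 1) + 2 = i + d + 3 by omega,
      comp_nuInv_nuInv_nu hr hl hn (by omega) (by omega) (by omega) (by omega)
        (by unfold Adj; omega),
      form_comp_nu_far hr hl hn hi (by omega) (by omega) (by omega)
        (fun t h1 h2 => by unfold Adj; omega),
      LinearMap.smul_comp, LinearMap.smul_comp]
  | succ c ih =>
    rw [show c + 1 + (k - i) = c + (k - i) + 1 by omega, form,
      comp_nuInv_nu_comm hr hl hn (by omega) (by omega) (by omega) (by omega)
        (by unfold Adj; omega), ih (by omega) (by omega), LinearMap.smul_comp]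

/-- Rests on φ_{i+1} ν_{i+2}⁻¹ ν_{i+1}⁻¹ = φ_{i+2}; the later factors ν_{i+3}⁻¹, … commute with
ν_{i+1}⁻¹. -/
theorem form_comp_nuInv_bot (hr : r ≠ 0) (hl : l ≠ 0) (hn : 2 ≤ n) {i d : ℕ} (hi : 1 ≤ i)
    (hd : i + d + 2 ≤ n) :
    form n l r i (d + 1) ∘ₗ nuInv n l r (i + 1) = form n l r (i + 1) d := by
  induction d with
  | zero =>
    rw [form, form, form, ← phi_comp_nuInv_adj hr hl hn (by omega) (by omega) (by omega) (by omega)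
      (by unfold Adj; omega), comp_nu_comp_nuInv hr hl hn (by omega) (by omega)]
  | succ d ih =>
    rw [form, comp_nuInv_nuInv_comm hr hl hn (by omega) (by omega) (by omega) (by omega)
      (by unfold Adj; omega), ih (by omega), form]
    congr 2
    omega

theorem form_comp_nu_bot (hr : r ≠ 0) (hl : l ≠ 0) (hn : 2 ≤ n) {i d : ℕ} (hi : 1 ≤ i)
    (hd : i + d + 2 ≤ n) :
    form n l r (i + 1) d ∘ₗ nu n l r (i + 1) = form n l r i (d + 1) := by
  rw [← form_comp_nuInv_bot hr hl hn hi hd, comp_nuInv_comp_nu hr hl hn (by omega) (by omega)]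

/-- The bridge between the two families: node 1 is joined to node 3 only, so ν_1 passes ν_4⁻¹,
ν_5⁻¹, … and then φ_3 ν_1 = φ_1 ν_3⁻¹. -/
theorem form_two_comp_nu_one (hr : r ≠ 0) (hl : l ≠ 0) (hn : 2 ≤ n) {d : ℕ} (hd : d + 3 ≤ n) :
    form n l r 2 d ∘ₗ nu n l r 1 = formHatOne n l r (d + 1) := by
  induction d with
  | zero =>
    rw [form, formHatOne, formHatOne]
    exact phi_comp_nuInv_adj hr hl hn (by omega) (by omega) (by omega) (by omega)
      (by unfold Adj; omega)
  | succ d ih =>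
    rw [form, comp_nuInv_nu_comm hr hl hn (by omega) (by omega) (by omega) (by omega)
      (by unfold Adj; omega), ih (by omega), formHatOne.eq_2 n l r (d + 1)]
    congr 2
    omega

theorem form_comp_nu_mem (hr : r ≠ 0) (hl : l ≠ 0) (hn : 2 ≤ n) {i d k : ℕ} (hi : 1 ≤ i)
    (hd : i + d + 1 ≤ n) (hk : 2 ≤ k) (hkn : k ≤ n) :
    form n l r i d ∘ₗ nu n l r k ∈ formSpan n l r := by
  have hf : form n l r i d ∈ formSpan n l r := form_mem hi hd
  -- The form involves the string of nodes i+1, …, i+d+1. The cases are: k apart from the string,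
  -- just below it (it grows downwards), its lowest node (it shrinks if d ≥ 1), inside it, its
  -- highest node (the last factor cancels), just above it (it grows upwards).
  obtain h | h | h | h | h | h : (k < i ∨ i + d + 2 < k) ∨ k = i ∨ k = i + 1 ∨
      (i + 2 ≤ k ∧ k ≤ i + d) ∨ (k = i + d + 1 ∧ 1 ≤ d) ∨ k = i + d + 2 := by omega
  · rw [form_comp_nu_far hr hl hn hi hd (by omega) hkn (fun t h1 h2 => by unfold Adj; omega)]
    exact Submodule.smul_mem _ _ hf
  · obtain ⟨i, rfl⟩ : ∃ j, i = j + 1 := ⟨i - 1, by omega⟩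
    rw [h, form_comp_nu_bot hr hl hn (by omega) (by omega)]
    exact form_mem (by omega) (by omega)
  · subst h
    cases d with
    | zero =>
      rw [form, phi_comp_nu_self hr hl hn (by omega) (by omega)]
      exact Submodule.smul_mem _ _ hf
    | succ d =>
      rw [← comp_nuInv_mem_iff hr hl hn (by omega) hkn hf (phi_mem hk hkn),
        form_comp_nuInv_bot hr hl hn hi (by omega)]
      exact form_mem (by omega) (by omega)
  · rw [form_comp_nu_interior hr hl hn hi hd h.1 h.2]
    exact Submodule.smul_mem _ _ hf
  · obtain ⟨d, rfl⟩ : ∃ j, d = j + 1 := ⟨d - 1, by omega⟩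
    rw [h.1, show i + (d + 1) + 1 = i + d + 2 by omega,
      form_succ_comp_nu_top hr hl hn (by omega)]
    exact form_mem (by omega) (by omega)
  · rw [← comp_nuInv_mem_iff hr hl hn (by omega) hkn hf (phi_mem hk hkn), h]
    exact form_mem (d := d + 1) hi (by omega)

/-- Stability of the smaller span under nodes 2, …, n is recorded separately: ν_1 maps this span
into `fullSpan` by `formSpan_comp_nu_one`, and the treatment of Ĉ_{ij} under node 1 relies on that.
-/
theorem formSpan_comp_nu (hr : r ≠ 0) (hl : l ≠ 0) (hn : 2 ≤ n) {k : ℕ} (hk : 2 ≤ k) (hkn : k ≤ n)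
    {f : Module.Dual F (Space F n)} (hf : f ∈ formSpan n l r) :
    f ∘ₗ nu n l r k ∈ formSpan n l r := by
  induction hf using Submodule.span_induction with
  | mem f hf =>
    obtain ⟨i, d, hi, hd, rfl⟩ := hf
    exact form_comp_nu_mem hr hl hn hi hd hk hkn
  | zero => rw [LinearMap.zero_comp]; exact zero_mem _
  | add f f' _ _ h h' => rw [LinearMap.add_comp]; exact add_mem h h'
  | smul c f _ h => rw [LinearMap.smul_comp]; exact Submodule.smul_mem _ _ h

theorem formSpan_comp_nuInv (hr : r ≠ 0) (hl : l ≠ 0) (hn : 2 ≤ n) {k : ℕ} (hk : 2 ≤ k)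
    (hkn : k ≤ n) {f : Module.Dual F (Space F n)} (hf : f ∈ formSpan n l r) :
    f ∘ₗ nuInv n l r k ∈ formSpan n l r :=
  (comp_nuInv_mem_iff hr hl hn (by omega) hkn hf (phi_mem hk hkn)).2
    (formSpan_comp_nu hr hl hn hk hkn hf)

/-! ### Nodes 2, …, n acting on the forms of the Ĉ_{ij} -/

theorem formHatOne_comp_nu_far (hr : r ≠ 0) (hl : l ≠ 0) (hn : 2 ≤ n) {d k : ℕ}
    (hk : d + 4 ≤ k) (hkn : k ≤ n) :
    formHatOne n l r d ∘ₗ nu n l r k = r • formHatOne n l r d := by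
  induction d with
  | zero =>
    exact phi_comp_nu_of_not_adj hr hl hn (by omega) (by omega) (by omega) hkn
      (by unfold Adj; omega) (by omega)
  | succ d ih =>
    rw [formHatOne, comp_nuInv_nu_comm hr hl hn (by omega) (by omega) (by omega) hkn
      (by unfold Adj; omega), ih (by omega), LinearMap.smul_comp]

theorem formHatOne_comp_nu_interior (hr : r ≠ 0) (hl : l ≠ 0) (hn : 2 ≤ n) {d k : ℕ}
    (hd : d + 2 ≤ n) (hk : 3 ≤ k) (hkd : k ≤ d + 1) :
    formHatOne n l r d ∘ₗ nu n l r k = r • formHatOne n l r d := by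
  obtain ⟨c, rfl⟩ : ∃ c, d = c + (k - 1) := ⟨d - (k - 1), by omega⟩
  induction c with
  | zero =>
    obtain ⟨d, rfl⟩ : ∃ d, k = d + 3 := ⟨k - 3, by omega⟩
    rw [show 0 + (d + 3 - 1) = d + 1 + 1 by omega, formHatOne, formHatOne,
      show d + 1 + 3 = d + 4 by omega,
      comp_nuInv_nuInv_nu hr hl hn (by omega) (by omega) (by omega) (by omega)
        (by unfold Adj; omega),
      formHatOne_comp_nu_far hr hl hn (by omega) (by omega),
      LinearMap.smul_comp, LinearMap.smul_comp]
  | succ c ih =>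
    rw [show c + 1 + (k - 1) = c + (k - 1) + 1 by omega, formHatOne,
      comp_nuInv_nu_comm hr hl hn (by omega) (by omega) (by omega) (by omega)
        (by unfold Adj; omega), ih (by omega) (by omega), LinearMap.smul_comp]

theorem formHat_comp_nu_of_lt (hr : r ≠ 0) (hl : l ≠ 0) (hn : 2 ≤ n) {d e k : ℕ}
    (hd : d + 2 ≤ n) (hek : e + 3 ≤ k) (hkn : k ≤ n)
    (h : k ≤ d + 1 ∨ d + 4 ≤ k) (he : e ≤ d) :
    formHat n l r d e ∘ₗ nu n l r k = r • formHat n l r d e := by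
  induction e with
  | zero =>
    rcases h with h | h
    · exact formHatOne_comp_nu_interior hr hl hn hd (by omega) h
    · exact formHatOne_comp_nu_far hr hl hn h hkn
  | succ e ih =>
    rw [formHat, comp_nuInv_nu_comm hr hl hn (by omega) (by omega) (by omega) hkn
      (by unfold Adj; omega), ih (by omega) (by omega), LinearMap.smul_comp]

theorem formHat_comp_nuInv_right (hr : r ≠ 0) (hl : l ≠ 0) (hn : 2 ≤ n) {d e : ℕ}
    (hd : d + 3 ≤ n) (he : e ≤ d) :
    formHat n l r d e ∘ₗ nuInv n l r (d + 3) = formHat n l r (d + 1) e := by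
  induction e with
  | zero => rfl
  | succ e ih =>
    rw [formHat, comp_nuInv_nuInv_comm hr hl hn (by omega) (by omega) (by omega) (by omega)
      (by unfold Adj; omega), ih (by omega), formHat]

theorem formHat_comp_nu_of_gt (hr : r ≠ 0) (hl : l ≠ 0) (hn : 2 ≤ n) {d e k : ℕ}
    (hd : d + 2 ≤ n) (hk : 2 ≤ k) (hke : k ≤ e) (he : e ≤ d) :
    formHat n l r d e ∘ₗ nu n l r k = r • formHat n l r d e := by
  obtain ⟨c, rfl⟩ : ∃ c, e = c + k := ⟨e - k, by omega⟩
  induction c with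
  | zero =>
    obtain ⟨k, rfl⟩ : ∃ j, k = j + 2 := ⟨k - 2, by omega⟩
    rw [show 0 + (k + 2) = k + 1 + 1 by omega, formHat, formHat,
      comp_nuInv_nuInv_nu hr hl hn (by omega) (by omega) (by omega) (by omega)
        (by unfold Adj; omega),
      formHat_comp_nu_of_lt hr hl hn hd (by omega) (by omega) (by omega) (by omega),
      LinearMap.smul_comp, LinearMap.smul_comp]
  | succ c ih =>
    rw [show c + 1 + k = c + k + 1 by omega, formHat,
      comp_nuInv_nu_comm hr hl hn (by omega) (by omega) (by omega) (by omega)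
        (by unfold Adj; omega), ih (by omega) (by omega), LinearMap.smul_comp]

/-- For consecutive indices i = e + 1, j = e + 2 the node e + 2 exchanges the two and fixes the
root. Inductively, the braid relation replaces ν_{e+3}⁻¹ ν_{e+2}⁻¹ ν_{e+3} by ν_{e+2} ν_{e+3}⁻¹
ν_{e+2}⁻¹; the start is that nodes 1 and 2 are not adjacent. -/
theorem formHat_comp_nu_diag (hr : r ≠ 0) (hl : l ≠ 0) (hn : 2 ≤ n) {e : ℕ} (he : e + 2 ≤ n) :
    formHat n l r e e ∘ₗ nu n l r (e + 2) = r • formHat n l r e e := by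
  induction e with
  | zero =>
    exact phi_comp_nu_of_not_adj hr hl hn (by omega) (by omega) (by omega) hn
      (by unfold Adj; omega) (by omega)
  | succ e ih =>
    rw [formHat, ← formHat_comp_nuInv_right hr hl hn (by omega) le_rfl,
      show e + 1 + 2 = e + 3 by omega,
      comp_nuInv_nuInv_nu hr hl hn (by omega) (by omega) (by omega) (by omega)
        (by unfold Adj; omega), ih (by omega), LinearMap.smul_comp, LinearMap.smul_comp]

theorem formHat_comp_nu_mem (hr : r ≠ 0) (hl : l ≠ 0) (hn : 2 ≤ n) {d e k : ℕ} (he : e ≤ d)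
    (hd : d + 2 ≤ n) (hk : 2 ≤ k) (hkn : k ≤ n) :
    formHat n l r d e ∘ₗ nu n l r k ∈ fullSpan n l r := by
  have hf : formHat n l r d e ∈ fullSpan n l r := formHat_mem he hd
  have hp := phi_mem_full (l := l) (r := r) hn (by omega : 1 ≤ k) hkn
  -- Node k exchanges the indices k-1 and k, so for Ĉ_{e+1,d+2} only k = e+1, e+2, d+2, d+3 can move
  -- an index; every other node, and the one exchanging both indices when e = d, acts by r.
  obtain h | h | h | h | h | h | h : k ≤ e ∨ (k = e + 1 ∧ 1 ≤ e) ∨ (k = e + 2 ∧ e = d) ∨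
      (k = e + 2 ∧ e < d) ∨ (e + 3 ≤ k ∧ (k ≤ d + 1 ∨ d + 4 ≤ k)) ∨ (k = d + 2 ∧ e < d) ∨
      k = d + 3 := by omega
  · rw [formHat_comp_nu_of_gt hr hl hn hd hk h he]
    exact Submodule.smul_mem _ _ hf
  · obtain ⟨e, rfl⟩ : ∃ j, e = j + 1 := ⟨e - 1, by omega⟩
    rw [h.1, formHat, comp_nuInv_comp_nu hr hl hn (by omega) (by omega)]
    exact formHat_mem (by omega) hd
  · obtain ⟨rfl, rfl⟩ := h
    rw [formHat_comp_nu_diag hr hl hn hd]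
    exact Submodule.smul_mem _ _ hf
  · rw [← comp_nuInv_mem_iff hr hl hn (by omega) hkn hf hp, h.1]
    exact formHat_mem (e := e + 1) (by omega) hd
  · rw [formHat_comp_nu_of_lt hr hl hn hd h.1 hkn h.2 he]
    exact Submodule.smul_mem _ _ hf
  · obtain ⟨d, rfl⟩ : ∃ j, d = j + 1 := ⟨d - 1, by omega⟩
    rw [h.1, ← formHat_comp_nuInv_right hr hl hn (by omega) (by omega),
      show d + 1 + 2 = d + 3 by omega, comp_nuInv_comp_nu hr hl hn (by omega) (by omega)]
    exact formHat_mem (by omega) (by omega)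
  · rw [← comp_nuInv_mem_iff hr hl hn (by omega) hkn hf hp, h,
      formHat_comp_nuInv_right hr hl hn (by omega) he]
    exact formHat_mem (by omega) (by omega)

theorem fullSpan_comp_nu_of_two_le (hr : r ≠ 0) (hl : l ≠ 0) (hn : 2 ≤ n) {k : ℕ} (hk : 2 ≤ k)
    (hkn : k ≤ n) {f : Module.Dual F (Space F n)} (hf : f ∈ fullSpan n l r) :
    f ∘ₗ nu n l r k ∈ fullSpan n l r := by
  obtain ⟨f₁, h₁, f₂, h₂, rfl⟩ := Submodule.mem_sup.1 hf
  rw [LinearMap.add_comp]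
  refine add_mem (Submodule.mem_sup_left (formSpan_comp_nu hr hl hn hk hkn h₁)) ?_
  clear hf
  induction h₂ using Submodule.span_induction with
  | mem f hf =>
    obtain ⟨d, e, he, hd, rfl⟩ := hf
    exact formHat_comp_nu_mem hr hl hn he hd hk hkn
  | zero => rw [LinearMap.zero_comp]; exact zero_mem _
  | add f f' _ _ h h' => rw [LinearMap.add_comp]; exact add_mem h h'
  | smul c f _ h => rw [LinearMap.smul_comp]; exact Submodule.smul_mem _ _ h

/-! ### Node 1 acting on both families -/

theorem form_comp_nu_one_mem (hr : r ≠ 0) (hl : l ≠ 0) (hn : 2 ≤ n) {i d : ℕ} (hi : 1 ≤ i)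
    (hd : i + d + 1 ≤ n) : form n l r i d ∘ₗ nu n l r 1 ∈ fullSpan n l r := by
  have hf : form n l r i d ∈ fullSpan n l r := form_mem_full hi hd
  -- The string i+1, …, i+d+1 avoids node 3, the only neighbour of node 1, exactly in the first
  -- alternative.
  obtain h | rfl | rfl : ((i = 1 ∧ d = 0) ∨ 3 ≤ i) ∨ i = 2 ∨ i = 1 := by omega
  · rw [form_comp_nu_far hr hl hn hi hd le_rfl (by omega) (fun t h1 h2 => by unfold Adj; omega)]
    exact Submodule.smul_mem _ _ hf
  · rw [form_two_comp_nu_one hr hl hn (by omega)]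
    exact formHat_mem (e := 0) (by omega) (by omega)
  · cases d with
    | zero =>
      rw [form_comp_nu_far hr hl hn hi hd le_rfl (by omega) (fun t h1 h2 => by unfold Adj; omega)]
      exact Submodule.smul_mem _ _ hf
    | succ d =>
      rw [← form_comp_nu_bot hr hl hn le_rfl (by omega),
        comp_nu_nu_comm hr hl (by omega) hn (by omega) (by omega) (by unfold Adj; omega),
        form_two_comp_nu_one hr hl hn (by omega)]
      exact fullSpan_comp_nu_of_two_le hr hl hn le_rfl hn
        (formHat_mem (e := 0) (by omega) (by omega))

theorem formSpan_comp_nu_one (hr : r ≠ 0) (hl : l ≠ 0) (hn : 2 ≤ n)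
    {f : Module.Dual F (Space F n)} (hf : f ∈ formSpan n l r) :
    f ∘ₗ nu n l r 1 ∈ fullSpan n l r := by
  induction hf using Submodule.span_induction with
  | mem f hf =>
    obtain ⟨i, d, hi, hd, rfl⟩ := hf
    exact form_comp_nu_one_mem hr hl hn hi hd
  | zero => rw [LinearMap.zero_comp]; exact zero_mem _
  | add f f' _ _ h h' => rw [LinearMap.add_comp]; exact add_mem h h'
  | smul c f _ h => rw [LinearMap.smul_comp]; exact Submodule.smul_mem _ _ h

theorem formSpan_comp_nuInv_one (hr : r ≠ 0) (hl : l ≠ 0) (hn : 2 ≤ n)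
    {f : Module.Dual F (Space F n)} (hf : f ∈ formSpan n l r) :
    f ∘ₗ nuInv n l r 1 ∈ fullSpan n l r :=
  (comp_nuInv_mem_iff hr hl hn le_rfl (by omega) (Submodule.mem_sup_left hf)
    (phi_mem_full hn le_rfl (by omega))).2 (formSpan_comp_nu_one hr hl hn hf)

/-- The inverse of ν_1 is the convenient choice: reading `form_two_comp_nu_one` backwards, it turns
the form of Ĉ_{1j}, j ≥ 3, into that of C_{2j}. -/
theorem formHat_comp_nuInv_one_mem (hr : r ≠ 0) (hl : l ≠ 0) (hn : 2 ≤ n) {d e : ℕ}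
    (he : e ≤ d) (hd : d + 2 ≤ n) :
    formHat n l r d e ∘ₗ nuInv n l r 1 ∈ fullSpan n l r := by
  have key : ∀ d, d + 3 ≤ n → formHat n l r (d + 1) 0 ∘ₗ nuInv n l r 1 = form n l r 2 d := by
    intro d hd
    rw [formHat, ← form_two_comp_nu_one hr hl hn hd,
      comp_nu_comp_nuInv hr hl hn le_rfl (by omega)]
  induction e with
  | zero =>
    cases d with
    | zero =>
      refine (comp_nuInv_mem_iff hr hl hn le_rfl (by omega) (formHat_mem he hd)
        (phi_mem_full hn le_rfl (by omega))).2 ?_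
      rw [formHat, formHatOne, phi_comp_nu_self hr hl hn le_rfl (by omega)]
      exact Submodule.smul_mem _ _ (phi_mem_full hn le_rfl (by omega))
    | succ d =>
      rw [key d (by omega)]
      exact form_mem_full (by omega) (by omega)
  | succ e ih =>
    obtain ⟨d, rfl⟩ : ∃ j, d = j + 1 := ⟨d - 1, by omega⟩
    -- The last factor of the form is ν_{e+2}⁻¹, which commutes with ν_1⁻¹ unless e = 1.
    obtain rfl | rfl | h : e = 0 ∨ e = 1 ∨ 2 ≤ e := by omega
    · rw [formHat, comp_nuInv_nuInv_comm hr hl hn (by omega) (by omega) (by omega) (by omega)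
        (by unfold Adj; omega), key d (by omega)]
      exact Submodule.mem_sup_left (formSpan_comp_nuInv hr hl hn le_rfl hn
        (form_mem (by omega) (by omega)))
    · have e1 : formHat n l r (d + 1) (0 + 1) =
          (form n l r 2 d ∘ₗ nuInv n l r 2) ∘ₗ nu n l r 1 := by
        refine eq_comp_nu hr hl hn le_rfl (by omega) ?_
        rw [formHat, comp_nuInv_nuInv_comm hr hl hn (by omega) (by omega) (by omega) (by omega)
          (by unfold Adj; omega), key d (by omega)]
      -- With h = `form n l r 2 d` ν_2⁻¹ the form becomes h ν_1 ν_3⁻¹ ν_1⁻¹ = h ν_3⁻¹ ν_1⁻¹ ν_3.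
      -- Since h ν_3⁻¹ is still in `formSpan`, applying ν_1⁻¹ to it is not circular.
      rw [formHat, e1, comp_nu_nuInv_nuInv hr hl hn le_rfl (by omega) (by omega) (by omega)
        (by unfold Adj; omega)]
      exact fullSpan_comp_nu_of_two_le hr hl hn (by omega) (by omega)
        (formSpan_comp_nuInv_one hr hl hn (formSpan_comp_nuInv hr hl hn (by omega) (by omega)
          (formSpan_comp_nuInv hr hl hn le_rfl hn (form_mem (by omega) (by omega)))))
    · have h1 := ih (by omega)
      rw [formHat, comp_nuInv_nuInv_comm hr hl hn (by omega) (by omega) (by omega) (by omega)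
        (by unfold Adj; omega)]
      exact (comp_nuInv_mem_iff hr hl hn (by omega) (by omega) h1
        (phi_mem_full hn (by omega) (by omega))).2
        (fullSpan_comp_nu_of_two_le hr hl hn (by omega) (by omega) h1)

theorem fullSpan_comp_nu (hr : r ≠ 0) (hl : l ≠ 0) (hn : 2 ≤ n) {k : ℕ} (hk : 1 ≤ k)
    (hkn : k ≤ n) {f : Module.Dual F (Space F n)} (hf : f ∈ fullSpan n l r) :
    f ∘ₗ nu n l r k ∈ fullSpan n l r := by
  obtain rfl | hk' : k = 1 ∨ 2 ≤ k := by omega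
  · obtain ⟨f₁, h₁, f₂, h₂, rfl⟩ := Submodule.mem_sup.1 hf
    rw [LinearMap.add_comp]
    refine add_mem (formSpan_comp_nu_one hr hl hn h₁) ?_
    clear hf
    induction h₂ using Submodule.span_induction with
    | mem f hf =>
      obtain ⟨d, e, he, hd, rfl⟩ := hf
      exact (comp_nuInv_mem_iff hr hl hn le_rfl (by omega) (formHat_mem he hd)
        (phi_mem_full hn le_rfl (by omega))).1 (formHat_comp_nuInv_one_mem hr hl hn he hd)
    | zero => rw [LinearMap.zero_comp]; exact zero_mem _
    | add f f' _ _ h h' => rw [LinearMap.add_comp]; exact add_mem h h'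
    | smul c f _ h => rw [LinearMap.smul_comp]; exact Submodule.smul_mem _ _ h
  · exact fullSpan_comp_nu_of_two_le hr hl hn hk' hkn hf

end Functionals

/-! ### Values of the forms on the basis vectors -/

section Gram

variable {F : Type*} [Field F] {n : ℕ} {l r : F}

/-- Most values of ν_k⁻¹ are read off from ν_k in this way; only `nuInv_s1` and `nuInv_t1` need the
expression of ν_k⁻¹ through the quadratic operator. -/
theorem nuInv_succ (hr : r ≠ 0) (hl : l ≠ 0) {j : ℕ} (hj : 1 ≤ j) (hjn : j + 1 ≤ n)
    {x y : Space F n} (h : nu n l r (j + 1) x = y) : nuInv n l r (j + 1) y = x := by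
  have := LinearMap.congr_fun (nuInv_mul_nu (n := n) hr hl (by omega) (by omega) hjn) x
  rwa [Module.End.mul_apply, h] at this

theorem nuInv_apply (k : ℕ) (x : Space F n) :
    nuInv n l r k x = nu n l r k x + (r⁻¹ - r) • x - l • quadOp n l r k x := by
  simp [nuInv]

theorem nuInv_diag_hat (hr : r ≠ 0) (hl : l ≠ 0) {j s t : ℕ} (hj : 1 ≤ j) (hjn : j + 1 ≤ n)
    (hs : s = j) (ht : t = j + 1) :
    nuInv n l r (j + 1) (wBar F n true s t) = r⁻¹ • wBar F n true s t := by
  refine nuInv_succ hr hl hj hjn ?_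
  rw [map_smul, nu_succ_diag_hat (by omega) (by omega) ht hjn, inv_smul_smul₀ hr]

theorem nuInv_diag (hr : r ≠ 0) (hl : l ≠ 0) {j s t : ℕ} (hj : 1 ≤ j) (hjn : j + 1 ≤ n)
    (hs : s = j) (ht : t = j + 1) :
    nuInv n l r (j + 1) (wBar F n false s t) = l • wBar F n false s t := by
  refine nuInv_succ hr hl hj hjn ?_
  rw [map_smul, nu_succ_diag (by omega) (by omega) ht hjn, smul_inv_smul₀ hl]

theorem nuInv_s0 (hr : r ≠ 0) (hl : l ≠ 0) {b : Bool} {j s t : ℕ} (hj : 1 ≤ j) (hs : s = j + 1)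
    (hst : s < t) (ht : t ≤ n) :
    nuInv n l r (j + 1) (wBar F n b s t) = wBar F n b j t := by
  subst hs
  exact nuInv_succ hr hl hj (by omega) (nu_succ_s1 (by omega) rfl hst ht)

theorem nuInv_t0 (hr : r ≠ 0) (hl : l ≠ 0) {b : Bool} {j s t : ℕ} (hs : 1 ≤ s) (hsj : s < j)
    (ht : t = j + 1) (hjn : j + 1 ≤ n) :
    nuInv n l r (j + 1) (wBar F n b s t) = wBar F n b s j := by
  subst ht
  exact nuInv_succ hr hl (by omega) hjn (nu_succ_t1 (by omega) hs hsj rfl hjn)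

theorem nuInv_far (hr : r ≠ 0) (hl : l ≠ 0) {b : Bool} {j s t : ℕ} (hj : 1 ≤ j) (hjn : j + 1 ≤ n)
    (hs : 1 ≤ s) (hst : s < t) (ht : t ≤ n) (h1 : s ≠ j) (h2 : s ≠ j + 1) (h3 : t ≠ j)
    (h4 : t ≠ j + 1) :
    nuInv n l r (j + 1) (wBar F n b s t) = r⁻¹ • wBar F n b s t := by
  refine nuInv_succ hr hl hj hjn ?_
  rw [map_smul, nu_succ_far (by omega) hs hst ht (by omega) (by omega) (by omega) (by omega),
    inv_smul_smul₀ hr]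

theorem nuInv_s1 (hr : r ≠ 0) (hl : l ≠ 0) {b : Bool} {j s t : ℕ} (hj : 1 ≤ j) (hs : s = j)
    (hst : j + 1 < t) (ht : t ≤ n) :
    nuInv n l r (j + 1) (wBar F n b s t) = wBar F n b (j + 1) t + (r⁻¹ - r) • wBar F n b s t -
      ((r⁻¹ - r) * r ^ ((t : ℤ) - j - 2) * (if b then r⁻¹ else l)) • w F n j (j + 1) := by
  subst hs
  rw [nuInv_apply, nu_succ_s1 (by omega) rfl hst ht,
    quad_succ hr hl hj (by omega) b hj (by omega) ht, if_pos rfl, if_neg (by omega), smul_smul]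
  congr 2
  cases b
  · simp only [Bool.false_eq_true, if_false]
    ring
  · simp only [if_true, mul_inv]
    field_simp

theorem nuInv_t1 (hr : r ≠ 0) (hl : l ≠ 0) {b : Bool} {j s t : ℕ} (hs : 1 ≤ s) (hst : s < j)
    (ht : t = j) (hjn : j + 1 ≤ n) :
    nuInv n l r (j + 1) (wBar F n b s t) = wBar F n b s (j + 1) + (r⁻¹ - r) • wBar F n b s t -
      ((r⁻¹ - r) * r ^ ((s : ℤ) - j + 1)) • w F n j (j + 1) := by
  subst ht
  rw [nuInv_apply, nu_succ_t1 (by omega) hs hst rfl hjn,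
    quad_succ hr hl (by omega) hjn b hs hst (by omega), if_neg (by omega), if_neg (by omega),
    if_pos rfl, smul_smul]
  congr 2
  field_simp

/-- The value at `w_{st}` (or at `ŵ_{st}` if `b` is true) of the linear form attached to
`C_{ij}`. -/
noncomputable def gram {F : Type*} [Field F] (l r : F) (i j : ℕ) (b : Bool) (s t : ℕ) : F :=
  let m : F := r⁻¹ - r
  if s < i then
    if t < i then 0
    else if t = i then m * l⁻¹ * r ^ ((s : ℤ) - j + 2)
    else if t < j then m ^ 2 * (l⁻¹ ^ 2 - r⁻¹ * l⁻¹) * r ^ ((s : ℤ) - i + t - j + 2)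
    else if t = j then m * l⁻¹ ^ 2 * r ^ ((s : ℤ) - i + 1)
    else 0
  else if s = i then
    if t < j then if b then m * l⁻¹ * r ^ ((t : ℤ) - j + 2) else m * l⁻¹ ^ 2 * r ^ ((t : ℤ) - j + 1)
    else if t = j then if b then 0 else l⁻¹ ^ 2 + m * l⁻¹ - 1
    else if b then m * l⁻¹ * r ^ ((t : ℤ) - j - 2) else m * r ^ ((t : ℤ) - j - 1)
  else if s < j then
    if t < j then
      if b then m ^ 2 * (1 + r ^ 2) * (l⁻¹ ^ 2 - r * l⁻¹) * r ^ ((s : ℤ) - i + t - j - 2) else 0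
    else if t = j then
      if b then m * l⁻¹ ^ 2 * r ^ ((s : ℤ) - i - 3) else m * r ^ ((s : ℤ) - i - 1)
    else m ^ 2 * (if b then l⁻¹ ^ 2 - r⁻¹ * l⁻¹ else r * l⁻¹ - 1) * r ^ ((s : ℤ) - i + t - j - 2)
  else if s = j then
    if b then m * l⁻¹ ^ 2 * r ^ ((t : ℤ) - i - 3) else m * l⁻¹ * r ^ ((t : ℤ) - i - 2)
  else 0

/-- The value at `w_{st}` (or at `ŵ_{st}` if `b` is true) of the linear form attached to
`Ĉ_{ij}`. -/
noncomputable def gramHat {F : Type*} [Field F] (l r : F) (i j : ℕ) (b : Bool) (s t : ℕ) : F :=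
  let m : F := r⁻¹ - r
  if s < i then
    if t < i then
      if b then m ^ 2 * (1 + r ^ 2) * (l⁻¹ ^ 2 - r * l⁻¹) * r ^ ((s : ℤ) + t - i - j + 2) else 0
    else if t = i then
      if b then m * l⁻¹ ^ 2 * r ^ ((s : ℤ) - j + 1) else m * r ^ ((s : ℤ) - j + 3)
    else if t < j then
      m ^ 2 * (if b then l⁻¹ ^ 2 - r⁻¹ * l⁻¹ else r * l⁻¹ - 1) * r ^ ((s : ℤ) - i + t - j + 2)
    else if t = j then
      if b then m * l⁻¹ ^ 2 * r ^ ((s : ℤ) - i + 1) else m * r ^ ((s : ℤ) - i + 3)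
    else if b then 0 else m ^ 2 * (1 + r ^ 2) * (r⁻¹ * l⁻¹ - 1) * r ^ ((s : ℤ) - i + t - j)
  else if s = i then
    if t < j then if b then m * l⁻¹ ^ 2 * r ^ ((t : ℤ) - j + 1) else m * l⁻¹ * r ^ ((t : ℤ) - j + 2)
    else if t = j then if b then l⁻¹ ^ 2 + m * l⁻¹ - 1 else 0
    else if b then m * r ^ ((t : ℤ) - j - 1) else m * l⁻¹ * r ^ ((t : ℤ) - j - 2)
  else if s < j then
    if t < j then 0
    else if t = j then m * r ^ ((s : ℤ) - i - 1)
    else m ^ 2 * (r * l⁻¹ - 1) * r ^ ((s : ℤ) - i + t - j - 2)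
  else if s = j then
    if b then m * r ^ ((t : ℤ) - i - 1) else m * l⁻¹ * r ^ ((t : ℤ) - i - 2)
  else if b then m ^ 2 * (1 + r ^ 2) * (r⁻¹ * l⁻¹ - 1) * r ^ ((s : ℤ) - i + t - j - 4) else 0

-- Appending ν_{j+1}⁻¹ passes from C_{ij} to C_{i,j+1}, so the table is checked by recursion on j.
-- Its branches depend only on order relations; once s and t are placed relative to i, j, j+1, each
-- case is a rational identity in l and powers of r.
set_option maxHeartbeats 4000000 in
theorem gram_step (hr : r ≠ 0) (hl : l ≠ 0) {i j : ℕ} (hi : 1 ≤ i) (hij : i < j)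
    (hjn : j + 1 ≤ n) {f : Module.Dual F (Space F n)}
    (hf : ∀ b s t, 1 ≤ s → s < t → t ≤ n → f (wBar F n b s t) = gram l r i j b s t)
    (b : Bool) {s t : ℕ} (hs : 1 ≤ s) (hst : s < t) (ht : t ≤ n) :
    f (nuInv n l r (j + 1) (wBar F n b s t)) = gram l r i (j + 1) b s t := by
  have key : ∀ x : ℕ, x < i ∨ x = i ∨ (i < x ∧ x < j) ∨ x = j ∨ x = j + 1 ∨ j + 1 < x := by omega
  rcases key s with h1 | rfl | h1 | rfl | rfl | h1 <;>
  rcases key t with h2 | rfl | h2 | rfl | rfl | h2 <;>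
  first
  | omega
  | cases b <;>
    · simp (disch := omega) only [nuInv_diag_hat hr hl, nuInv_diag hr hl, nuInv_s0 hr hl,
        nuInv_t0 hr hl, nuInv_s1 hr hl, nuInv_t1 hr hl, nuInv_far hr hl, w, map_add, map_sub,
        map_smul, hf, smul_eq_mul]
      simp (disch := omega) only [gram, if_pos, if_neg, if_true, Bool.false_eq_true, if_false]
      all_goals try
        simp only [Nat.cast_add, Nat.cast_one, zpow_add₀ hr, zpow_sub₀ hr, zpow_natCast,
          zpow_ofNat]
      all_goals try (field_simp <;> ring)

set_option maxHeartbeats 4000000 in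
theorem gramHat_step_right (hr : r ≠ 0) (hl : l ≠ 0) {i j : ℕ} (hi : 1 ≤ i) (hij : i < j)
    (hjn : j + 1 ≤ n) {f : Module.Dual F (Space F n)}
    (hf : ∀ b s t, 1 ≤ s → s < t → t ≤ n → f (wBar F n b s t) = gramHat l r i j b s t)
    (b : Bool) {s t : ℕ} (hs : 1 ≤ s) (hst : s < t) (ht : t ≤ n) :
    f (nuInv n l r (j + 1) (wBar F n b s t)) = gramHat l r i (j + 1) b s t := by
  have key : ∀ x : ℕ, x < i ∨ x = i ∨ (i < x ∧ x < j) ∨ x = j ∨ x = j + 1 ∨ j + 1 < x := by omega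
  rcases key s with h1 | rfl | h1 | rfl | rfl | h1 <;>
  rcases key t with h2 | rfl | h2 | rfl | rfl | h2 <;>
  first
  | omega
  | cases b <;>
    · simp (disch := omega) only [nuInv_diag_hat hr hl, nuInv_diag hr hl, nuInv_s0 hr hl,
        nuInv_t0 hr hl, nuInv_s1 hr hl, nuInv_t1 hr hl, nuInv_far hr hl, w, map_add, map_sub,
        map_smul, hf, smul_eq_mul]
      simp (disch := omega) only [gramHat, if_pos, if_neg, if_true, Bool.false_eq_true, if_false]
      all_goals try
        simp only [Nat.cast_add, Nat.cast_one, zpow_add₀ hr, zpow_sub₀ hr, zpow_natCast,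
          zpow_ofNat]
      all_goals try (field_simp <;> ring)

set_option maxHeartbeats 4000000 in
theorem gramHat_step_left (hr : r ≠ 0) (hl : l ≠ 0) {i j : ℕ} (hi : 1 ≤ i) (hij : i + 1 < j)
    (hjn : j ≤ n) {f : Module.Dual F (Space F n)}
    (hf : ∀ b s t, 1 ≤ s → s < t → t ≤ n → f (wBar F n b s t) = gramHat l r i j b s t)
    (b : Bool) {s t : ℕ} (hs : 1 ≤ s) (hst : s < t) (ht : t ≤ n) :
    f (nuInv n l r (i + 1) (wBar F n b s t)) = gramHat l r (i + 1) j b s t := by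
  have key : ∀ x : ℕ, x < i ∨ x = i ∨ x = i + 1 ∨ (i + 1 < x ∧ x < j) ∨ x = j ∨ j < x := by omega
  rcases key s with h1 | rfl | rfl | h1 | rfl | h1 <;>
  rcases key t with h2 | rfl | rfl | h2 | rfl | h2 <;>
  first
  | omega
  | cases b <;>
    · simp (disch := omega) only [nuInv_diag_hat hr hl, nuInv_diag hr hl, nuInv_s0 hr hl,
        nuInv_t0 hr hl, nuInv_s1 hr hl, nuInv_t1 hr hl, nuInv_far hr hl, w, map_add, map_sub,
        map_smul, hf, smul_eq_mul]
      simp (disch := omega) only [gramHat, if_pos, if_neg, if_true, Bool.false_eq_true, if_false]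
      all_goals try
        simp only [Nat.cast_add, Nat.cast_one, zpow_add₀ hr, zpow_sub₀ hr, zpow_natCast,
          zpow_ofNat]
      all_goals try (field_simp <;> ring)

theorem phi_succ_wBar (hr : r ≠ 0) (hl : l ≠ 0) {i : ℕ} (hi : 1 ≤ i) (hin : i + 1 ≤ n) (b : Bool)
    {s t : ℕ} (hs : 1 ≤ s) (hst : s < t) (ht : t ≤ n) :
    phi n l r (i + 1) (wBar F n b s t) = gram l r i (i + 1) b s t := by
  refine phi_eq_of_quadOp hr hl (by omega) (by omega) hin ?_
  have hroot : rootVec F n (i + 1) = w F n i (i + 1) := by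
    simp [rootVec, show i ≠ 0 by omega]
  rw [quad_succ hr hl hi hin b hs hst ht, hroot]
  congr 1
  have key : ∀ x : ℕ, x < i ∨ x = i ∨ x = i + 1 ∨ i + 1 < x := by omega
  rcases key s with h1 | rfl | rfl | h1 <;> rcases key t with h2 | rfl | rfl | h2 <;>
  first
  | omega
  | cases b <;>
    · simp (disch := omega) only [gram, if_pos, if_neg, if_true, Bool.false_eq_true, if_false]
      all_goals try
        simp only [Nat.cast_add, Nat.cast_one, zpow_add₀ hr, zpow_sub₀ hr, zpow_natCast,
          zpow_ofNat]
      all_goals try field_simp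

theorem phi_one_wBar (hr : r ≠ 0) (hl : l ≠ 0) (hn : 2 ≤ n) (b : Bool)
    {s t : ℕ} (hs : 1 ≤ s) (hst : s < t) (ht : t ≤ n) :
    phi n l r 1 (wBar F n b s t) = gramHat l r 1 2 b s t := by
  refine phi_eq_of_quadOp hr hl hn le_rfl (by omega) ?_
  rw [quad_one hr hl hn b hs hst ht, rootVec, if_pos rfl]
  congr 1
  have key : ∀ x : ℕ, 1 ≤ x → x = 1 ∨ x = 2 ∨ 2 < x := by omega
  rcases key s hs with rfl | rfl | h1 <;> rcases key t (by omega) with rfl | rfl | h2 <;>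
  first
  | omega
  | cases b <;>
    · simp (disch := omega) only [gramHat, if_pos, if_neg, if_true, Bool.false_eq_true, if_false]
      all_goals try
        simp only [Nat.cast_one, Nat.cast_ofNat, zpow_add₀ hr, zpow_sub₀ hr, zpow_natCast,
          zpow_ofNat]
      all_goals try field_simp

theorem form_wBar (hr : r ≠ 0) (hl : l ≠ 0) {i d : ℕ} (hi : 1 ≤ i) (hd : i + d + 1 ≤ n) (b : Bool)
    (s t : ℕ) (hs : 1 ≤ s) (hst : s < t) (ht : t ≤ n) :
    form n l r i d (wBar F n b s t) = gram l r i (i + d + 1) b s t := by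
  induction d generalizing b s t with
  | zero => exact phi_succ_wBar hr hl hi hd b hs hst ht
  | succ d ih =>
    exact gram_step hr hl hi (by omega) hd
      (fun b s t hs hst ht => ih (by omega) b s t hs hst ht) b hs hst ht

/-- The recursion follows the order of the inverse factors: the right index grows from 2 first, with
left index 1, and then the left index grows. -/
theorem formHat_wBar (hr : r ≠ 0) (hl : l ≠ 0) {d e : ℕ} (he : e ≤ d) (hd : d + 2 ≤ n) (b : Bool)
    (s t : ℕ) (hs : 1 ≤ s) (hst : s < t) (ht : t ≤ n) :
    formHat n l r d e (wBar F n b s t) = gramHat l r (e + 1) (d + 2) b s t := by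
  induction e generalizing b s t with
  | zero =>
    clear he
    induction d generalizing b s t with
    | zero => exact phi_one_wBar hr hl hd b hs hst ht
    | succ d ih =>
      exact gramHat_step_right hr hl le_rfl (by omega) hd
        (fun b s t hs hst ht => ih (by omega) b s t hs hst ht) b hs hst ht
  | succ e ih =>
    exact gramHat_step_left hr hl (by omega) (by omega) hd
      (fun b s t hs hst ht => ih (by omega) b s t hs hst ht) b hs hst ht

end Gram

/-! ### K(n) as the common zeros of the forms; invariance and properness -/

section Kernel

variable {F : Type*} [Field F] {n : ℕ} {l r : F}

theorem isUnit_g_all (hl : l ≠ 0) {m : F} (hm : m ≠ 0) (k : ℕ) : IsUnit (g F n l m k) := by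
  by_cases h : 1 ≤ k ∧ k ≤ n
  · exact (isUnit_g hl hm h.1 h.2).1
  · simp [g, h]

theorem isUnit_gProd (hl : l ≠ 0) {m : F} (hm : m ≠ 0) (s t : ℕ) :
    IsUnit (gProd F n l m s t) := by
  refine List.prod_isUnit fun x hx => ?_
  obtain ⟨k, -, rfl⟩ := List.mem_map.1 hx
  exact isUnit_g_all hl hm k

theorem gStar_self (m : F) (s : ℕ) : gStar F n l m s s = gInv F n l m s := by
  simp [gStar, path]

theorem gStar_succ (m : F) {s t : ℕ} (h : s ≤ t) :
    gStar F n l m s (t + 1) = gStar F n l m s t * gInv F n l m (t + 1) := by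
  have e : t + 1 + 1 - s = (t + 1 - s) + 1 := by omega
  simp only [gStar, path, h, show s ≤ t + 1 by omega, if_true, e, List.range'_concat,
    List.map_append, List.prod_append, List.map_cons, List.map_nil, List.prod_singleton]
  congr 2
  omega

theorem rep_gInv (hn : 4 ≤ n) (hr : r ≠ 0) (hr2 : r ^ 2 ≠ 1) (hl : l ≠ 0) {k : ℕ} (hk : 1 ≤ k)
    (hkn : k ≤ n) : rep hn hr hr2 hl (gInv F n l (r⁻¹ - r) k) = nuInv n l r k := by
  have hm := sub_ne hr hr2
  rw [(isUnit_g hl hm hk hkn).2, map_sub, map_add, map_smul, map_smul, map_one, rep_g hn hr hr2 hl hk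
    hkn, rep_e hn hr hr2 hl hk hkn, smul_smul, mul_div_cancel₀ _ hm]
  rfl

theorem form_succ_eq (hn : 4 ≤ n) (hr : r ≠ 0) (hr2 : r ^ 2 ≠ 1) (hl : l ≠ 0) {i d : ℕ}
    (hd : i + d + 2 ≤ n) : form n l r i (d + 1) =
      phi n l r (i + 1) ∘ₗ rep hn hr hr2 hl (gStar F n l (r⁻¹ - r) (i + 2) (i + d + 2)) := by
  induction d with
  | zero =>
    rw [form, form, Nat.add_zero, gStar_self, rep_gInv hn hr hr2 hl (by omega) (by omega)]
  | succ d ih =>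
    rw [form, ih (by omega), show i + (d + 1) + 2 = i + d + 2 + 1 by omega,
      gStar_succ _ (show i + 2 ≤ i + d + 2 by omega), map_mul, rep_gInv hn hr hr2 hl (by omega) (by omega),
      Module.End.mul_eq_comp, LinearMap.comp_assoc]

theorem formHatOne_succ_eq (hn : 4 ≤ n) (hr : r ≠ 0) (hr2 : r ^ 2 ≠ 1) (hl : l ≠ 0) {d : ℕ}
    (hd : d + 3 ≤ n) : formHatOne n l r (d + 1) =
      phi n l r 1 ∘ₗ rep hn hr hr2 hl (gStar F n l (r⁻¹ - r) 3 (d + 3)) := by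
  induction d with
  | zero =>
    rw [formHatOne, formHatOne, Nat.zero_add, gStar_self,
      rep_gInv hn hr hr2 hl (by omega) (by omega)]
  | succ d ih =>
    rw [formHatOne, ih (by omega), show d + 1 + 3 = d + 3 + 1 by omega,
      gStar_succ _ (show 3 ≤ d + 3 by omega), map_mul, rep_gInv hn hr hr2 hl (by omega) (by omega),
      Module.End.mul_eq_comp, LinearMap.comp_assoc]

theorem formHat_succ_eq (hn : 4 ≤ n) (hr : r ≠ 0) (hr2 : r ^ 2 ≠ 1) (hl : l ≠ 0) {d e : ℕ}
    (hd : e + 2 ≤ n) : formHat n l r d (e + 1) =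
      formHatOne n l r d ∘ₗ rep hn hr hr2 hl (gStar F n l (r⁻¹ - r) 2 (e + 2)) := by
  induction e with
  | zero =>
    rw [formHat, formHat, Nat.zero_add, gStar_self,
      rep_gInv hn hr hr2 hl (by omega) (by omega)]
  | succ e ih =>
    rw [formHat, ih (by omega), show e + 1 + 2 = e + 2 + 1 by omega,
      gStar_succ _ (show 2 ≤ e + 2 by omega), map_mul, rep_gInv hn hr hr2 hl (by omega) (by omega),
      Module.End.mul_eq_comp, LinearMap.comp_assoc]

theorem rep_e_apply_eq_zero_iff (hn : 4 ≤ n) (hr : r ≠ 0) (hr2 : r ^ 2 ≠ 1) (hl : l ≠ 0) {k : ℕ}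
    (hk : 1 ≤ k) (hkn : k ≤ n) (x : Space F n) :
    rep hn hr hr2 hl (e F n l (r⁻¹ - r) k) x = 0 ↔ phi n l r k x = 0 := by
  have hm := sub_ne hr hr2
  have e1 : rep hn hr hr2 hl (e F n l (r⁻¹ - r) k) = (l / (r⁻¹ - r)) • quadOp n l r k :=
    rep_e hn hr hr2 hl hk hkn
  rw [e1, LinearMap.smul_apply, quadOp_apply hr hl (by omega) hk hkn,
    smul_eq_zero_iff_right (div_ne_zero hl hm),
    smul_eq_zero_iff_left (rootVec_ne_zero (by omega) hk hkn)]

theorem rep_apply_eq_zero_iff_of_isUnit {A V : Type*} [Ring A] [Algebra F A] [AddCommMonoid V]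
    [Module F V] (ρ : A →ₐ[F] Module.End F V) {u : A} (hu : IsUnit u) (x : V) :
    ρ u x = 0 ↔ x = 0 := by
  obtain ⟨u, rfl⟩ := hu
  refine ⟨fun h => ?_, fun h => by rw [h, map_zero]⟩
  have : ρ ↑u⁻¹ (ρ ↑u x) = x := by
    rw [← Module.End.mul_apply, ← map_mul, Units.inv_mul, map_one, Module.End.one_apply]
  rw [← this, h, map_zero]

theorem rep_C_apply_eq_zero_iff (hn : 4 ≤ n) (hr : r ≠ 0) (hr2 : r ^ 2 ≠ 1) (hl : l ≠ 0) {i d : ℕ}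
    (hi : 1 ≤ i) (hd : i + d + 1 ≤ n) (x : Space F n) :
    rep hn hr hr2 hl (C F n l (r⁻¹ - r) i (i + d + 1)) x = 0 ↔ form n l r i d x = 0 := by
  cases d with
  | zero =>
    rw [C, if_pos (by omega), rep_e_apply_eq_zero_iff hn hr hr2 hl (by omega) (by omega), form]
  | succ d =>
    rw [C, if_neg (by omega), map_mul, map_mul, Module.End.mul_apply, Module.End.mul_apply,
      rep_apply_eq_zero_iff_of_isUnit _ (isUnit_gProd hl (sub_ne hr hr2) _ _),
      rep_e_apply_eq_zero_iff hn hr hr2 hl (by omega) (by omega),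
      form_succ_eq hn hr hr2 hl (by omega)]
    rfl

theorem rep_CHat_apply_eq_zero_iff (hn : 4 ≤ n) (hr : r ≠ 0) (hr2 : r ^ 2 ≠ 1) (hl : l ≠ 0)
    {d e : ℕ} (he : e ≤ d) (hd : d + 2 ≤ n) (x : Space F n) :
    rep hn hr hr2 hl (CHat F n l (r⁻¹ - r) (e + 1) (d + 2)) x = 0 ↔ formHat n l r d e x = 0 := by
  have hu := fun s t => isUnit_gProd (n := n) hl (sub_ne hr hr2) s t
  cases e with
  | zero =>
    cases d with
    | zero =>
      rw [CHat, if_pos rfl, if_pos rfl, rep_e_apply_eq_zero_iff hn hr hr2 hl le_rfl (by omega)]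
      rfl
    | succ d =>
      rw [CHat, if_pos rfl, if_neg (by omega), map_mul, map_mul, Module.End.mul_apply,
        Module.End.mul_apply, rep_apply_eq_zero_iff_of_isUnit _ (hu _ _),
        rep_e_apply_eq_zero_iff hn hr hr2 hl le_rfl (by omega), formHat,
        formHatOne_succ_eq hn hr hr2 hl (by omega)]
      rfl
  | succ e =>
    obtain ⟨d, rfl⟩ : ∃ j, d = j + 1 := ⟨d - 1, by omega⟩
    rw [CHat, if_neg (by omega), map_mul, map_mul, map_mul, Module.End.mul_apply,
      Module.End.mul_apply, Module.End.mul_apply,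
      rep_apply_eq_zero_iff_of_isUnit _ ((hu _ _).mul (hu _ _)),
      rep_e_apply_eq_zero_iff hn hr hr2 hl le_rfl (by omega),
      formHat_succ_eq hn hr hr2 hl (by omega), formHatOne_succ_eq hn hr hr2 hl (by omega)]
    rfl

/-- The factors to the left of e_k are units and do not change the kernel; e_k itself vanishes
exactly on the kernel of φ_k; the factors to its right are absorbed into the form. -/
theorem mem_K_iff (hn : 4 ≤ n) (hr : r ≠ 0) (hr2 : r ^ 2 ≠ 1) (hl : l ≠ 0) {x : Space F n} :
    x ∈ K (rep hn hr hr2 hl) ↔ (∀ i d, 1 ≤ i → i + d + 1 ≤ n → form n l r i d x = 0) ∧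
      ∀ d e, e ≤ d → d + 2 ≤ n → formHat n l r d e x = 0 := by
  simp only [K, Submodule.mem_inf, Submodule.mem_iInf, LinearMap.mem_ker]
  refine and_congr ⟨fun h i d hi hd => ?_, fun h i j hij => ?_⟩
    ⟨fun h d e he hd => ?_, fun h i j hij => ?_⟩
  · exact (rep_C_apply_eq_zero_iff hn hr hr2 hl hi hd x).1 (h i (i + d + 1) (by omega))
  · obtain ⟨d, rfl⟩ : ∃ d, j = i + d + 1 := ⟨j - i - 1, by omega⟩
    exact (rep_C_apply_eq_zero_iff hn hr hr2 hl hij.1 hij.2.2 x).2 (h i d hij.1 hij.2.2)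
  · exact (rep_CHat_apply_eq_zero_iff hn hr hr2 hl he hd x).1 (h (e + 1) (d + 2) (by omega))
  · obtain ⟨e, rfl⟩ : ∃ e, i = e + 1 := ⟨i - 1, by omega⟩
    obtain ⟨d, rfl⟩ : ∃ d, j = d + 2 := ⟨j - 2, by omega⟩
    exact (rep_CHat_apply_eq_zero_iff hn hr hr2 hl (by omega) hij.2.2 x).2
      (h d e (by omega) hij.2.2)

theorem apply_eq_zero_of_mem_fullSpan {x : Space F n}
    (h : (∀ i d, 1 ≤ i → i + d + 1 ≤ n → form n l r i d x = 0) ∧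
      ∀ d e, e ≤ d → d + 2 ≤ n → formHat n l r d e x = 0)
    {f : Module.Dual F (Space F n)} (hf : f ∈ fullSpan n l r) : f x = 0 := by
  have : fullSpan n l r ≤ LinearMap.ker (Module.Dual.eval F (Space F n) x) := by
    refine sup_le (Submodule.span_le.2 ?_) (Submodule.span_le.2 ?_)
    · rintro _ ⟨i, d, hi, hd, rfl⟩
      exact h.1 i d hi hd
    · rintro _ ⟨d, e, he, hd, rfl⟩
      exact h.2 d e he hd
  exact this hf

/-- A form evaluated at ν_k x is its composite with ν_k evaluated at x, and that composite lies in
the span of forms vanishing at x. The generators e_k even act as zero on K(n), because φ_k is one of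
the forms. -/
theorem rep_apply_mem_K (hn : 4 ≤ n) (hr : r ≠ 0) (hr2 : r ^ 2 ≠ 1) (hl : l ≠ 0)
    (a : CGW F n l (r⁻¹ - r)) (x : Space F n) (hx : x ∈ K (rep hn hr hr2 hl)) :
    rep hn hr hr2 hl a x ∈ K (rep hn hr hr2 hl) := by
  have hnu : ∀ k, 1 ≤ k → k ≤ n → ∀ x ∈ K (rep hn hr hr2 hl),
      nu n l r k x ∈ K (rep hn hr hr2 hl) := by
    intro k hk hkn x hx
    rw [mem_K_iff] at hx ⊢
    refine ⟨fun i d hi hd => ?_, fun d e he hd => ?_⟩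
    · exact apply_eq_zero_of_mem_fullSpan hx
        (fullSpan_comp_nu hr hl (by omega) hk hkn (form_mem_full hi hd))
    · exact apply_eq_zero_of_mem_fullSpan hx
        (fullSpan_comp_nu hr hl (by omega) hk hkn (formHat_mem he hd))
  obtain ⟨a, rfl⟩ := RingQuot.mkAlgHom_surjective F (Rel F n l (r⁻¹ - r)) a
  induction a using FreeAlgebra.induction generalizing x with
  | grade0 c =>
    rw [AlgHom.commutes, AlgHom.commutes, Module.algebraMap_end_apply]
    exact Submodule.smul_mem _ _ hx
  | grade1 y =>
    obtain ⟨k, hk, hkn⟩ | ⟨k, hk, hkn⟩ := y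
    · have : RingQuot.mkAlgHom F (Rel F n l (r⁻¹ - r)) (FreeAlgebra.ι F (Gen.g ⟨k, hk, hkn⟩)) =
          g F n l (r⁻¹ - r) k := by simp [g, hk, hkn]
      rw [this, rep_g hn hr hr2 hl hk hkn]
      exact hnu k hk hkn x hx
    · have : RingQuot.mkAlgHom F (Rel F n l (r⁻¹ - r)) (FreeAlgebra.ι F (Gen.e ⟨k, hk, hkn⟩)) =
          e F n l (r⁻¹ - r) k := by simp [e, hk, hkn]
      rw [this, (rep_e_apply_eq_zero_iff hn hr hr2 hl hk hkn x).2
        (apply_eq_zero_of_mem_fullSpan ((mem_K_iff hn hr hr2 hl).1 hx)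
          (phi_mem_full (by omega) hk hkn))]
      exact zero_mem _
  | mul a b ha hb =>
    rw [map_mul, map_mul, Module.End.mul_apply]
    exact ha _ (hb _ hx)
  | add a b ha hb =>
    rw [map_add, map_add, LinearMap.add_apply]
    exact add_mem (ha _ hx) (hb _ hx)

theorem K_ne_top (hn : 4 ≤ n) (hr : r ≠ 0) (hr2 : r ^ 2 ≠ 1) (hl : l ≠ 0) :
    K (rep hn hr hr2 hl) ≠ ⊤ := by
  intro h
  have h1 : wBar F n false 1 3 ∈ K (rep hn hr hr2 hl) := h ▸ Submodule.mem_top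
  -- The form of C_{12} = e_2 takes the nonzero value m at w_{13}.
  have h2 := ((mem_K_iff hn hr hr2 hl).1 h1).1 1 0 le_rfl (by omega)
  rw [form_wBar hr hl le_rfl (by omega) false 1 3 le_rfl (by omega) (by omega)] at h2
  simp [gram] at h2
  exact sub_ne hr hr2 h2

theorem isReducible_of_mem_K (hn : 4 ≤ n) (hr : r ≠ 0) (hr2 : r ^ 2 ≠ 1) (hl : l ≠ 0)
    {x : Space F n} (hx : x ∈ K (rep hn hr hr2 hl)) (hx0 : x ≠ 0) :
    IsReducible (rep hn hr hr2 hl) :=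
  ⟨K (rep hn hr hr2 hl), rep_apply_mem_K hn hr hr2 hl,
    fun h => hx0 ((Submodule.mem_bot F).1 (h ▸ hx)), K_ne_top hn hr hr2 hl⟩

end Kernel

/-! ### The vectors X, Y and Z -/

section Vectors

variable {F : Type*} [Field F] {n : ℕ} {l r : F}

/-- This and the next three statements read off one coordinate at which the vector has coefficient
1. -/
theorem vecX_ne_zero (hn : 4 ≤ n) : vecX (F := F) n r ≠ 0 := by
  intro h
  have := congrArg (coord F n false 2 4) h
  simp [vecX, coord_of_ne, coord_self false (show 1 ≤ 2 by omega) (show 2 < 4 by omega) hn] at this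

theorem vecY_ne_zero (hn : 5 ≤ n) : vecY (F := F) n r ≠ 0 := by
  intro h
  have := congrArg (coord F n false 3 4) h
  simp [vecY, coord_of_ne,
    coord_self false (show 1 ≤ 3 by omega) (show 3 < 4 by omega) (show 4 ≤ n by omega)] at this

theorem vecZ_ne_zero (hn : 4 ≤ n) : vecZ (F := F) n r ≠ 0 := by
  intro h
  have := congrArg (coord F n false 2 3) h
  simp [vecZ, coord_of_ne,
    coord_self false (show 1 ≤ 2 by omega) (show 2 < 3 by omega) (show 3 ≤ n by omega)] at this

theorem vecJ_ne_zero (hn : 4 ≤ n) : vecJ (F := F) n r ≠ 0 := by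
  intro h
  have := congrArg (coord F n true 1 2) h
  simp [vecJ, coord_of_ne,
    coord_self true (show 1 ≤ 1 by omega) (show 1 < 2 by omega) (show 2 ≤ n by omega)] at this

set_option maxHeartbeats 4000000 in
theorem vecX_apply_of_gram (hr : r ≠ 0) (hn : 4 ≤ n) {i j : ℕ} (hi : 1 ≤ i)
    (hij : i < j) {f : Module.Dual F (Space F n)}
    (hf : ∀ b s t, 1 ≤ s → s < t → t ≤ n → f (wBar F n b s t) = gram (r ^ 3) r i j b s t) :
    f (vecX n r) = 0 := by
  simp (disch := omega) only [vecX, w, wHat, map_add, map_sub, map_smul, hf, smul_eq_mul]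
  -- The support involves only the indices 1 to 4, so all larger values of i or j fall into the same
  -- branches of the table and are treated symbolically.
  have key : ∀ x : ℕ, 1 ≤ x → x = 1 ∨ x = 2 ∨ x = 3 ∨ x = 4 ∨ 4 < x := by omega
  rcases key i hi with rfl | rfl | rfl | rfl | h1 <;>
  rcases key j (by omega) with rfl | rfl | rfl | rfl | h2 <;>
  first
  | omega
  | (simp (disch := omega) only [gram, if_pos, if_neg, if_true, Bool.false_eq_true, if_false]
     try simp only [Nat.cast_one, Nat.cast_ofNat, zpow_add₀ hr, zpow_sub₀ hr,
          zpow_natCast, zpow_ofNat]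
     try field_simp
     try ring)

set_option maxHeartbeats 4000000 in
theorem vecX_apply_of_gramHat (hr : r ≠ 0) (hn : 4 ≤ n) {i j : ℕ} (hi : 1 ≤ i)
    (hij : i < j) {f : Module.Dual F (Space F n)}
    (hf : ∀ b s t, 1 ≤ s → s < t → t ≤ n → f (wBar F n b s t) = gramHat (r ^ 3) r i j b s t) :
    f (vecX n r) = 0 := by
  simp (disch := omega) only [vecX, w, wHat, map_add, map_sub, map_smul, hf, smul_eq_mul]
  have key : ∀ x : ℕ, 1 ≤ x → x = 1 ∨ x = 2 ∨ x = 3 ∨ x = 4 ∨ 4 < x := by omega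
  rcases key i hi with rfl | rfl | rfl | rfl | h1 <;>
  rcases key j (by omega) with rfl | rfl | rfl | rfl | h2 <;>
  first
  | omega
  | (simp (disch := omega) only [gramHat, if_pos, if_neg, if_true, Bool.false_eq_true, if_false]
     try simp only [Nat.cast_one, Nat.cast_ofNat, zpow_add₀ hr, zpow_sub₀ hr,
          zpow_natCast, zpow_ofNat]
     try field_simp
     try ring)

set_option maxHeartbeats 4000000 in
theorem vecY_apply_of_gram (hr : r ≠ 0) (hn : 5 ≤ n) {i j : ℕ} (hi : 1 ≤ i)
    (hij : i < j) {f : Module.Dual F (Space F n)}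
    (hf : ∀ b s t, 1 ≤ s → s < t → t ≤ n → f (wBar F n b s t) = gram (-r ^ 3) r i j b s t) :
    f (vecY n r) = 0 := by
  simp (disch := omega) only [vecY, w, map_add, map_sub, map_smul, hf, smul_eq_mul]
  have key : ∀ x : ℕ, x < 3 ∨ x = 3 ∨ x = 4 ∨ x = 5 ∨ 5 < x := by omega
  rcases key i with h1 | rfl | rfl | rfl | h1 <;>
  rcases key j with h2 | rfl | rfl | rfl | h2 <;>
  first
  | omega
  | (simp (disch := omega) only [gram, if_pos, if_neg, if_true, Bool.false_eq_true, if_false]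
     try simp only [Nat.cast_ofNat, zpow_add₀ hr, zpow_sub₀ hr,
          zpow_natCast, zpow_ofNat]
     try field_simp
     try ring)

set_option maxHeartbeats 4000000 in
theorem vecY_apply_of_gramHat (hr : r ≠ 0) (hn : 5 ≤ n) {i j : ℕ} (hi : 1 ≤ i)
    (hij : i < j) {f : Module.Dual F (Space F n)}
    (hf : ∀ b s t, 1 ≤ s → s < t → t ≤ n → f (wBar F n b s t) = gramHat (-r ^ 3) r i j b s t) :
    f (vecY n r) = 0 := by
  simp (disch := omega) only [vecY, w, map_add, map_sub, map_smul, hf, smul_eq_mul]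
  have key : ∀ x : ℕ, x < 3 ∨ x = 3 ∨ x = 4 ∨ x = 5 ∨ 5 < x := by omega
  rcases key i with h1 | rfl | rfl | rfl | h1 <;>
  rcases key j with h2 | rfl | rfl | rfl | h2 <;>
  first
  | omega
  | (simp (disch := omega) only [gramHat, if_pos, if_neg, if_true, Bool.false_eq_true, if_false]
     try simp only [Nat.cast_ofNat, zpow_add₀ hr, zpow_sub₀ hr,
          zpow_natCast, zpow_ofNat]
     try field_simp
     try ring)

set_option maxHeartbeats 4000000 in
theorem vecZ_apply_of_gram (hr : r ≠ 0) (hn : 4 ≤ n) {i j : ℕ} (hi : 1 ≤ i)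
    (hij : i < j) {f : Module.Dual F (Space F n)}
    (hf : ∀ b s t, 1 ≤ s → s < t → t ≤ n → f (wBar F n b s t) = gram (-r ^ 3) r i j b s t) :
    f (vecZ n r) = 0 := by
  simp (disch := omega) only [vecZ, w, wHat, map_add, map_sub, map_smul, hf, smul_eq_mul]
  have key : ∀ x : ℕ, 1 ≤ x → x = 1 ∨ x = 2 ∨ x = 3 ∨ x = 4 ∨ 4 < x := by omega
  rcases key i hi with rfl | rfl | rfl | rfl | h1 <;>
  rcases key j (by omega) with rfl | rfl | rfl | rfl | h2 <;>
  first
  | omega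
  | (simp (disch := omega) only [gram, if_pos, if_neg, if_true, Bool.false_eq_true, if_false]
     try simp only [Nat.cast_one, Nat.cast_ofNat, zpow_add₀ hr, zpow_sub₀ hr,
          zpow_natCast, zpow_ofNat]
     try field_simp
     try ring)

set_option maxHeartbeats 4000000 in
theorem vecZ_apply_of_gramHat (hr : r ≠ 0) (hn : 4 ≤ n) {i j : ℕ} (hi : 1 ≤ i)
    (hij : i < j) {f : Module.Dual F (Space F n)}
    (hf : ∀ b s t, 1 ≤ s → s < t → t ≤ n → f (wBar F n b s t) = gramHat (-r ^ 3) r i j b s t) :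
    f (vecZ n r) = 0 := by
  simp (disch := omega) only [vecZ, w, wHat, map_add, map_sub, map_smul, hf, smul_eq_mul]
  have key : ∀ x : ℕ, 1 ≤ x → x = 1 ∨ x = 2 ∨ x = 3 ∨ x = 4 ∨ 4 < x := by omega
  rcases key i hi with rfl | rfl | rfl | rfl | h1 <;>
  rcases key j (by omega) with rfl | rfl | rfl | rfl | h2 <;>
  first
  | omega
  | (simp (disch := omega) only [gramHat, if_pos, if_neg, if_true, Bool.false_eq_true, if_false]
     try simp only [Nat.cast_one, Nat.cast_ofNat, zpow_add₀ hr, zpow_sub₀ hr,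
          zpow_natCast, zpow_ofNat]
     try field_simp
     try ring)

theorem mem_K_of_gram (hn : 4 ≤ n) (hr : r ≠ 0) (hr2 : r ^ 2 ≠ 1) (hl : l ≠ 0) {x : Space F n}
    (h : ∀ i j, 1 ≤ i → i < j → ∀ f : Module.Dual F (Space F n),
      (∀ b s t, 1 ≤ s → s < t → t ≤ n → f (wBar F n b s t) = gram l r i j b s t) → f x = 0)
    (h' : ∀ i j, 1 ≤ i → i < j → ∀ f : Module.Dual F (Space F n),
      (∀ b s t, 1 ≤ s → s < t → t ≤ n → f (wBar F n b s t) = gramHat l r i j b s t) → f x = 0) :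
    x ∈ K (rep hn hr hr2 hl) :=
  (mem_K_iff hn hr hr2 hl).2
    ⟨fun _ _ hi hd => h _ _ hi (by omega) _ (form_wBar hr hl hi hd),
      fun _ _ he hd => h' _ _ (by omega) (by omega) _ (formHat_wBar hr hl he hd)⟩

theorem vecX_mem_K (hn : 4 ≤ n) (hr : r ≠ 0) (hr2 : r ^ 2 ≠ 1) (hl : l ≠ 0) (h : l = r ^ 3) :
    vecX n r ∈ K (rep hn hr hr2 hl) := by
  subst h
  exact mem_K_of_gram hn hr hr2 hl (fun _ _ hi hij _ hf => vecX_apply_of_gram hr hn hi hij hf)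
    (fun _ _ hi hij _ hf => vecX_apply_of_gramHat hr hn hi hij hf)

theorem vecY_mem_K (hn : 4 ≤ n) (hr : r ≠ 0) (hr2 : r ^ 2 ≠ 1) (hl : l ≠ 0) (h : l = -r ^ 3)
    (hn5 : 5 ≤ n) : vecY n r ∈ K (rep hn hr hr2 hl) := by
  subst h
  exact mem_K_of_gram hn hr hr2 hl (fun _ _ hi hij _ hf => vecY_apply_of_gram hr hn5 hi hij hf)
    (fun _ _ hi hij _ hf => vecY_apply_of_gramHat hr hn5 hi hij hf)

/-- Valid for every n ≥ 4, not only for n = 4, so Z alone yields reducibility when l = -r³. -/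
theorem vecZ_mem_K (hn : 4 ≤ n) (hr : r ≠ 0) (hr2 : r ^ 2 ≠ 1) (hl : l ≠ 0) (h : l = -r ^ 3) :
    vecZ n r ∈ K (rep hn hr hr2 hl) := by
  subst h
  exact mem_K_of_gram hn hr hr2 hl (fun _ _ hi hij _ hf => vecZ_apply_of_gram hr hn hi hij hf)
    (fun _ _ hi hij _ hf => vecZ_apply_of_gramHat hr hn hi hij hf)

end Vectors

/-! ### J_n as a common eigenvector of ν_5, …, ν_n -/

section VectorJ

variable {F : Type*} [Field F] {n : ℕ} {l r : F}

theorem sum_Icc_of_telescope {a : ℕ} (ha : a ≤ n + 1) (T U : ℕ → F)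
    (h : ∀ j, a ≤ j → j ≤ n → T j = U j - U (j + 1)) :
    ∑ j ∈ Finset.Icc a n, T j = U a - U (n + 1) := by
  have e : ∑ j ∈ Finset.Icc a n, T j = ∑ j ∈ Finset.Ico a (n + 1), -(U (j + 1) - U j) := by
    rw [← Finset.Ico_add_one_right_eq_Icc]
    refine Finset.sum_congr rfl fun j hj => ?_
    rw [Finset.mem_Ico] at hj
    rw [h j hj.1 (by omega), neg_sub]
  rw [e, Finset.sum_neg_distrib, Finset.sum_Ico_sub _ ha, neg_sub]

/-- The vector `(w_{3j} - ŵ_{3j}) - r (w_{2j} - ŵ_{2j})` occurring in `J_n`. -/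
noncomputable def vecJTerm {F : Type*} [Field F] (n : ℕ) (r : F) (j : ℕ) : Space F n :=
  (w F n 3 j - wHat F n 3 j) - r • (w F n 2 j - wHat F n 2 j)

/-- The part of `J_n` supported on the first three indices. -/
noncomputable def vecJHead {F : Type*} [Field F] (n : ℕ) (r : F) : Space F n :=
  (wHat F n 1 2 + r ^ (2 * (n : ℤ) - 6) • w F n 1 2)
    - (1 / r) • (wHat F n 1 3 + r ^ (2 * (n : ℤ) - 6) • w F n 1 3)
    - (1 + r ^ (2 * (n : ℤ) - 6)) • w F n 2 3

theorem vecJ_eq : vecJ n r = vecJHead n r +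
    r • ∑ j ∈ Finset.Icc 4 n, r ^ ((j : ℤ) - 5) • vecJTerm n r j := rfl

theorem nu_vecJHead {k : ℕ} (hn : 4 ≤ n) (hk : 5 ≤ k) :
    nu n l r k (vecJHead n r) = r • vecJHead n r := by
  simp (disch := omega) only [vecJHead, w, wHat, map_add, map_sub, map_smul, nu_succ_far]
  module

theorem nu_vecJTerm_far {k j : ℕ} (hk : 5 ≤ k) (hj : 4 ≤ j) (hjn : j ≤ n) (h1 : j ≠ k)
    (h2 : j + 1 ≠ k) : nu n l r k (vecJTerm n r j) = r • vecJTerm n r j := by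
  simp (disch := omega) only [vecJTerm, w, wHat, map_sub, map_smul, nu_succ_far]
  module

theorem nu_vecJTerm_pred {k : ℕ} (hk : 4 ≤ k) (hkn : k + 1 ≤ n) :
    nu n l r (k + 1) (vecJTerm n r k) = vecJTerm n r (k + 1) := by
  simp (disch := omega) only [vecJTerm, w, wHat, map_sub, map_smul, nu_succ_t1]

/-- The multiples of w_{k,k+1} produced by w_{s,k+1} and by ŵ_{s,k+1} are equal, so they cancel in
the differences. -/
theorem nu_vecJTerm_self {k : ℕ} (hk : 4 ≤ k) (hkn : k + 1 ≤ n) :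
    nu n l r (k + 1) (vecJTerm n r (k + 1)) =
      vecJTerm n r k - (r⁻¹ - r) • vecJTerm n r (k + 1) := by
  simp (disch := omega) only [vecJTerm, w, wHat, map_sub, map_smul, nu_succ_t0,
    Nat.add_sub_cancel]
  module

/-- Writing T_j for `vecJTerm n r j`, only T_{k-1} and T_k interact, and T_{k-1} + r T_k is an
eigenvector with eigenvalue r because 1 - m r = r². This explains the weights r^{j-5}. -/
theorem nu_vecJ (hr : r ≠ 0) (hn : 4 ≤ n) {k : ℕ} (hk : 5 ≤ k) (hkn : k ≤ n) :
    nu n l r k (vecJ n r) = r • vecJ n r := by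
  have hsum : ∑ j ∈ Finset.Icc 4 n, r ^ ((j : ℤ) - 5) •
      (nu n l r k (vecJTerm n r j) - r • vecJTerm n r j) = 0 := by
    obtain ⟨k, rfl⟩ : ∃ p, k = p + 1 := ⟨k - 1, by omega⟩
    rw [Finset.sum_eq_add k (k + 1) (by omega)]
    · rw [nu_vecJTerm_pred (by omega) hkn, nu_vecJTerm_self (by omega) hkn]
      have e : r ^ (((k + 1 : ℕ) : ℤ) - 5) = r * r ^ ((k : ℤ) - 5) := by
        rw [← zpow_one_add₀ hr]
        congr 1
        push_cast
        ring
      rw [e]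
      match_scalars <;> field_simp <;> ring
    · intro j hj hne
      rw [Finset.mem_Icc] at hj
      rw [nu_vecJTerm_far hk hj.1 hj.2 (by omega) (by omega), sub_self, smul_zero]
    · exact fun h => absurd (Finset.mem_Icc.2 ⟨by omega, by omega⟩) h
    · exact fun h => absurd (Finset.mem_Icc.2 ⟨by omega, by omega⟩) h
  simp only [smul_sub, Finset.sum_sub_distrib, sub_eq_zero] at hsum
  rw [vecJ_eq, map_add, nu_vecJHead hn hk, map_smul, map_sum, smul_add]
  simp only [map_smul, hsum]
  rw [Finset.smul_sum (r := r) (f := fun j : ℕ => r ^ ((j : ℤ) - 5) • vecJTerm n r j)]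
  congr 2
  exact Finset.sum_congr rfl fun j _ => smul_comm _ _ _

theorem nuInv_vecJ (hr : r ≠ 0) (hl : l ≠ 0) (hn : 4 ≤ n) {k : ℕ} (hk : 5 ≤ k) (hkn : k ≤ n) :
    nuInv n l r k (vecJ n r) = r⁻¹ • vecJ n r := by
  obtain ⟨k, rfl⟩ : ∃ p, k = p + 1 := ⟨k - 1, by omega⟩
  refine nuInv_succ hr hl (by omega) hkn ?_
  rw [map_smul, nu_vecJ hr hn hk hkn, inv_smul_smul₀ hr]

/-- On an eigenvector with eigenvalue r the quadratic operator is r² + m r - 1 = 0. -/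
theorem phi_vecJ (hr : r ≠ 0) (hl : l ≠ 0) (hn : 4 ≤ n) {k : ℕ} (hk : 5 ≤ k) (hkn : k ≤ n) :
    phi n l r k (vecJ n r) = 0 := by
  refine phi_eq_of_quadOp hr hl (by omega) (by omega) hkn ?_
  simp only [quadOp, pow_two, LinearMap.sub_apply, LinearMap.add_apply, LinearMap.smul_apply,
    Module.End.mul_apply, Module.End.one_apply, nu_vecJ hr hn hk hkn, map_smul]
  rw [zero_smul]
  match_scalars
  field_simp
  ring

/-- Evaluation of `J_n` by telescoping the sum over `j ≥ 5`. -/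
theorem vecJ_apply_eq_zero (hr : r ≠ 0) (hn : 4 ≤ n) (f : Module.Dual F (Space F n)) (U : ℕ → F)
    (hU : ∀ j, 5 ≤ j → j ≤ n → r ^ ((j : ℤ) - 4) * f (vecJTerm n r j) = U j - U (j + 1))
    (h : f (vecJHead n r) + f (vecJTerm n r 4) + (U 5 - U (n + 1)) = 0) :
    f (vecJ n r) = 0 := by
  have e : f (vecJ n r) = f (vecJHead n r) +
      ∑ j ∈ Finset.Icc 4 n, r ^ ((j : ℤ) - 4) * f (vecJTerm n r j) := by
    rw [vecJ_eq, map_add, map_smul, map_sum, smul_eq_mul, Finset.mul_sum]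
    congr 1
    refine Finset.sum_congr rfl fun j _ => ?_
    rw [map_smul, smul_eq_mul, ← mul_assoc, ← zpow_one_add₀ hr]
    congr 2
    ring
  have e2 : Finset.Icc 4 n = insert 4 (Finset.Icc 5 n) := by
    ext j
    simp only [Finset.mem_insert, Finset.mem_Icc]
    omega
  rw [e, e2, Finset.sum_insert (by simp), sum_Icc_of_telescope (by omega) _ U hU, ← h]
  simp [add_assoc]

end VectorJ

/-! ### Evaluation of the remaining forms at J_n -/

section VectorJ

set_option linter.unusedSimpArgs false

variable {F : Type*} [Field F] {n : ℕ} {l r : F}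

/-- Here and in the next lemma the exponents depending on n are expressed through r^n, so that the
closing identities become rational in r and r^n. -/
theorem zpow_two_mul_sub_six (hr : r ≠ 0) : r ^ (2 * (n : ℤ) - 6) = (r ^ n) ^ 2 / r ^ 6 := by
  rw [zpow_sub₀ hr, mul_comm, zpow_mul, zpow_natCast]
  norm_cast

theorem inv_eq_of_eq_neg_zpow (hr : r ≠ 0) (h : l = -(1 / r ^ (2 * (n : ℤ) - 5))) :
    l⁻¹ = -((r ^ n) ^ 2 / r ^ 5) := by
  rw [h, inv_neg, one_div, inv_inv, zpow_sub₀ hr, mul_comm, zpow_mul, zpow_natCast]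
  norm_cast

-- For t ≥ 5 the summand r^{t-4} f(T_t) is a constant times (r^t)², and the constant is divisible by
-- m. As m r = 1 - r², it is a difference U(t) - U(t+1) with U again a constant times (r^t)². This
-- holds for every l; the prescribed l is used only in the closing identity, which balances the
-- head, the term at 4 and the boundary values of U.
set_option maxHeartbeats 4000000 in
theorem vecJ_apply_of_gram (hr : r ≠ 0) (hl : l ≠ 0) (hn : 4 ≤ n)
    (h : l = -(1 / r ^ (2 * (n : ℤ) - 5))) {i j : ℕ} (hi : 1 ≤ i) (hij : i < j) (hj : j ≤ 4)
    {f : Module.Dual F (Space F n)}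
    (hf : ∀ b s t, 1 ≤ s → s < t → t ≤ n → f (wBar F n b s t) = gram l r i j b s t) :
    f (vecJ n r) = 0 := by
  have hl' := inv_eq_of_eq_neg_zpow hr h
  have hz := zpow_two_mul_sub_six (n := n) hr
  obtain ⟨rfl, rfl⟩ | ⟨rfl, rfl⟩ | ⟨rfl, rfl⟩ | ⟨rfl, rfl⟩ | ⟨rfl, rfl⟩ | ⟨rfl, rfl⟩ :
      i = 1 ∧ j = 2 ∨ i = 1 ∧ j = 3 ∨ i = 1 ∧ j = 4 ∨ i = 2 ∧ j = 3 ∨ i = 2 ∧ j = 4 ∨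
        i = 3 ∧ j = 4 := by omega
  -- In each case the constant in U is the coefficient of (r^t)² in the summand divided by m r.
  · refine vecJ_apply_eq_zero hr hn f
      (fun t => (l⁻¹ ^ 2 / r ^ 8 - l⁻¹ / r ^ 7) * (r ^ t) ^ 2) ?_ ?_
    · intro t ht htn
      simp (disch := omega) only [vecJTerm, w, wHat, map_sub, map_smul, hf, smul_eq_mul, gram,
        if_pos, if_neg, if_true, Bool.false_eq_true, if_false, Nat.cast_one, Nat.cast_ofNat,
        zpow_add₀ hr, zpow_sub₀ hr, zpow_natCast, zpow_ofNat, zpow_one]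
      field_simp
      ring
    · simp (disch := omega) only [vecJHead, vecJTerm, w, wHat, map_add, map_sub, map_smul, hf,
        smul_eq_mul, gram, if_pos, if_neg, if_true, Bool.false_eq_true, if_false, Nat.cast_one,
        Nat.cast_ofNat, hz, zpow_add₀ hr, zpow_sub₀ hr, zpow_natCast, zpow_ofNat, zpow_one, hl']
      field_simp
      ring
  · refine vecJ_apply_eq_zero hr hn f
      (fun t => (-l⁻¹ / r ^ 10 + 1 / r ^ 9 + l⁻¹ / r ^ 8 - l⁻¹ ^ 2 / r ^ 7 - 1 / r ^ 7 +
        l⁻¹ / r ^ 6) * (r ^ t) ^ 2) ?_ ?_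
    · intro t ht htn
      simp (disch := omega) only [vecJTerm, w, wHat, map_sub, map_smul, hf, smul_eq_mul, gram,
        if_pos, if_neg, if_true, Bool.false_eq_true, if_false, Nat.cast_one, Nat.cast_ofNat,
        zpow_add₀ hr, zpow_sub₀ hr, zpow_natCast, zpow_ofNat, zpow_one]
      field_simp
      ring
    · simp (disch := omega) only [vecJHead, vecJTerm, w, wHat, map_add, map_sub, map_smul, hf,
        smul_eq_mul, gram, if_pos, if_neg, if_true, Bool.false_eq_true, if_false, Nat.cast_one,
        Nat.cast_ofNat, hz, zpow_add₀ hr, zpow_sub₀ hr, zpow_natCast, zpow_ofNat, zpow_one, hl']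
      field_simp
      ring
  -- Here the values at s = 3 are r times those at s = 2, so T_t contributes nothing and U = 0.
  · refine vecJ_apply_eq_zero hr hn f (fun _ => 0) ?_ ?_
    · intro t ht htn
      simp (disch := omega) only [vecJTerm, w, wHat, map_sub, map_smul, hf, smul_eq_mul, gram,
        if_pos, if_neg, if_true, Bool.false_eq_true, if_false, Nat.cast_one, Nat.cast_ofNat,
        zpow_add₀ hr, zpow_sub₀ hr, zpow_natCast, zpow_ofNat, zpow_one]
      field_simp
      ring
    · simp (disch := omega) only [vecJHead, vecJTerm, w, wHat, map_add, map_sub, map_smul, hf,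
        smul_eq_mul, gram, if_pos, if_neg, if_true, Bool.false_eq_true, if_false, Nat.cast_one,
        Nat.cast_ofNat, hz, zpow_add₀ hr, zpow_sub₀ hr, zpow_natCast, zpow_ofNat, zpow_one, hl']
      field_simp
      ring
  · refine vecJ_apply_eq_zero hr hn f
      (fun t => (-l⁻¹ ^ 2 / r ^ 10 + 2 * l⁻¹ / r ^ 9 - 1 / r ^ 8) * (r ^ t) ^ 2) ?_ ?_
    · intro t ht htn
      simp (disch := omega) only [vecJTerm, w, wHat, map_sub, map_smul, hf, smul_eq_mul, gram,
        if_pos, if_neg, if_true, Bool.false_eq_true, if_false, Nat.cast_one, Nat.cast_ofNat,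
        zpow_add₀ hr, zpow_sub₀ hr, zpow_natCast, zpow_ofNat, zpow_one]
      field_simp
      ring
    · simp (disch := omega) only [vecJHead, vecJTerm, w, wHat, map_add, map_sub, map_smul, hf,
        smul_eq_mul, gram, if_pos, if_neg, if_true, Bool.false_eq_true, if_false, Nat.cast_one,
        Nat.cast_ofNat, hz, zpow_add₀ hr, zpow_sub₀ hr, zpow_natCast, zpow_ofNat, zpow_one, hl']
      field_simp
      ring
  · refine vecJ_apply_eq_zero hr hn f
      (fun t => (l⁻¹ / r ^ 12 - l⁻¹ ^ 2 / r ^ 11 - 1 / r ^ 11 + l⁻¹ / r ^ 10 + l⁻¹ ^ 2 / r ^ 9 -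
        l⁻¹ / r ^ 8) * (r ^ t) ^ 2) ?_ ?_
    · intro t ht htn
      simp (disch := omega) only [vecJTerm, w, wHat, map_sub, map_smul, hf, smul_eq_mul, gram,
        if_pos, if_neg, if_true, Bool.false_eq_true, if_false, Nat.cast_one, Nat.cast_ofNat,
        zpow_add₀ hr, zpow_sub₀ hr, zpow_natCast, zpow_ofNat, zpow_one]
      field_simp
      ring
    · simp (disch := omega) only [vecJHead, vecJTerm, w, wHat, map_add, map_sub, map_smul, hf,
        smul_eq_mul, gram, if_pos, if_neg, if_true, Bool.false_eq_true, if_false, Nat.cast_one,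
        Nat.cast_ofNat, hz, zpow_add₀ hr, zpow_sub₀ hr, zpow_natCast, zpow_ofNat, zpow_one, hl']
      field_simp
      ring
  · refine vecJ_apply_eq_zero hr hn f
      (fun t => (-l⁻¹ / r ^ 11 + 1 / r ^ 10) * (r ^ t) ^ 2) ?_ ?_
    · intro t ht htn
      simp (disch := omega) only [vecJTerm, w, wHat, map_sub, map_smul, hf, smul_eq_mul, gram,
        if_pos, if_neg, if_true, Bool.false_eq_true, if_false, Nat.cast_one, Nat.cast_ofNat,
        zpow_add₀ hr, zpow_sub₀ hr, zpow_natCast, zpow_ofNat, zpow_one]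
      field_simp
      ring
    · simp (disch := omega) only [vecJHead, vecJTerm, w, wHat, map_add, map_sub, map_smul, hf,
        smul_eq_mul, gram, if_pos, if_neg, if_true, Bool.false_eq_true, if_false, Nat.cast_one,
        Nat.cast_ofNat, hz, zpow_add₀ hr, zpow_sub₀ hr, zpow_natCast, zpow_ofNat, zpow_one, hl']
      field_simp
      ring

set_option maxHeartbeats 4000000 in
theorem vecJ_apply_of_gramHat (hr : r ≠ 0) (hl : l ≠ 0) (hn : 4 ≤ n)
    (h : l = -(1 / r ^ (2 * (n : ℤ) - 5))) {i j : ℕ} (hi : 1 ≤ i) (hij : i < j) (hj : j ≤ 4)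
    {f : Module.Dual F (Space F n)}
    (hf : ∀ b s t, 1 ≤ s → s < t → t ≤ n → f (wBar F n b s t) = gramHat l r i j b s t) :
    f (vecJ n r) = 0 := by
  have hl' := inv_eq_of_eq_neg_zpow hr h
  have hz := zpow_two_mul_sub_six (n := n) hr
  obtain ⟨rfl, rfl⟩ | ⟨rfl, rfl⟩ | ⟨rfl, rfl⟩ | ⟨rfl, rfl⟩ | ⟨rfl, rfl⟩ | ⟨rfl, rfl⟩ :
      i = 1 ∧ j = 2 ∨ i = 1 ∧ j = 3 ∨ i = 1 ∧ j = 4 ∨ i = 2 ∧ j = 3 ∨ i = 2 ∧ j = 4 ∨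
        i = 3 ∧ j = 4 := by omega
  · refine vecJ_apply_eq_zero hr hn f
      (fun t => (-l⁻¹ / r ^ 11 + 1 / r ^ 10) * (r ^ t) ^ 2) ?_ ?_
    · intro t ht htn
      simp (disch := omega) only [vecJTerm, w, wHat, map_sub, map_smul, hf, smul_eq_mul, gramHat,
        if_pos, if_neg, if_true, Bool.false_eq_true, if_false, Nat.cast_one, Nat.cast_ofNat,
        zpow_add₀ hr, zpow_sub₀ hr, zpow_natCast, zpow_ofNat, zpow_one]
      field_simp
      ring
    · simp (disch := omega) only [vecJHead, vecJTerm, w, wHat, map_add, map_sub, map_smul, hf,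
        smul_eq_mul, gramHat, if_pos, if_neg, if_true, Bool.false_eq_true, if_false, Nat.cast_one,
        Nat.cast_ofNat, hz, zpow_add₀ hr, zpow_sub₀ hr, zpow_natCast, zpow_ofNat, zpow_one, hl']
      field_simp
      ring
  · refine vecJ_apply_eq_zero hr hn f
      (fun t => (l⁻¹ / r ^ 8 - 1 / r ^ 7) * (r ^ t) ^ 2) ?_ ?_
    · intro t ht htn
      simp (disch := omega) only [vecJTerm, w, wHat, map_sub, map_smul, hf, smul_eq_mul, gramHat,
        if_pos, if_neg, if_true, Bool.false_eq_true, if_false, Nat.cast_one, Nat.cast_ofNat,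
        zpow_add₀ hr, zpow_sub₀ hr, zpow_natCast, zpow_ofNat, zpow_one]
      field_simp
      ring
    · simp (disch := omega) only [vecJHead, vecJTerm, w, wHat, map_add, map_sub, map_smul, hf,
        smul_eq_mul, gramHat, if_pos, if_neg, if_true, Bool.false_eq_true, if_false, Nat.cast_one,
        Nat.cast_ofNat, hz, zpow_add₀ hr, zpow_sub₀ hr, zpow_natCast, zpow_ofNat, zpow_one, hl']
      field_simp
      ring
  · refine vecJ_apply_eq_zero hr hn f (fun _ => 0) ?_ ?_
    · intro t ht htn
      simp (disch := omega) only [vecJTerm, w, wHat, map_sub, map_smul, hf, smul_eq_mul, gramHat,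
        if_pos, if_neg, if_true, Bool.false_eq_true, if_false, Nat.cast_one, Nat.cast_ofNat,
        zpow_add₀ hr, zpow_sub₀ hr, zpow_natCast, zpow_ofNat, zpow_one]
      field_simp
      ring
    · simp (disch := omega) only [vecJHead, vecJTerm, w, wHat, map_add, map_sub, map_smul, hf,
        smul_eq_mul, gramHat, if_pos, if_neg, if_true, Bool.false_eq_true, if_false, Nat.cast_one,
        Nat.cast_ofNat, hz, zpow_add₀ hr, zpow_sub₀ hr, zpow_natCast, zpow_ofNat, zpow_one, hl']
      field_simp
      ring
  · refine vecJ_apply_eq_zero hr hn f (fun _ => 0) ?_ ?_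
    · intro t ht htn
      simp (disch := omega) only [vecJTerm, w, wHat, map_sub, map_smul, hf, smul_eq_mul, gramHat,
        if_pos, if_neg, if_true, Bool.false_eq_true, if_false, Nat.cast_one, Nat.cast_ofNat,
        zpow_add₀ hr, zpow_sub₀ hr, zpow_natCast, zpow_ofNat, zpow_one]
      field_simp
      ring
    · simp (disch := omega) only [vecJHead, vecJTerm, w, wHat, map_add, map_sub, map_smul, hf,
        smul_eq_mul, gramHat, if_pos, if_neg, if_true, Bool.false_eq_true, if_false, Nat.cast_one,
        Nat.cast_ofNat, hz, zpow_add₀ hr, zpow_sub₀ hr, zpow_natCast, zpow_ofNat, zpow_one, hl']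
      field_simp
      ring
  · refine vecJ_apply_eq_zero hr hn f
      (fun t => (-l⁻¹ / r ^ 10 + 1 / r ^ 9) * (r ^ t) ^ 2) ?_ ?_
    · intro t ht htn
      simp (disch := omega) only [vecJTerm, w, wHat, map_sub, map_smul, hf, smul_eq_mul, gramHat,
        if_pos, if_neg, if_true, Bool.false_eq_true, if_false, Nat.cast_one, Nat.cast_ofNat,
        zpow_add₀ hr, zpow_sub₀ hr, zpow_natCast, zpow_ofNat, zpow_one]
      field_simp
      ring
    · simp (disch := omega) only [vecJHead, vecJTerm, w, wHat, map_add, map_sub, map_smul, hf,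
        smul_eq_mul, gramHat, if_pos, if_neg, if_true, Bool.false_eq_true, if_false, Nat.cast_one,
        Nat.cast_ofNat, hz, zpow_add₀ hr, zpow_sub₀ hr, zpow_natCast, zpow_ofNat, zpow_one, hl']
      field_simp
      ring
  · refine vecJ_apply_eq_zero hr hn f
      (fun t => (l⁻¹ / r ^ 7 - 1 / r ^ 6) * (r ^ t) ^ 2) ?_ ?_
    · intro t ht htn
      simp (disch := omega) only [vecJTerm, w, wHat, map_sub, map_smul, hf, smul_eq_mul, gramHat,
        if_pos, if_neg, if_true, Bool.false_eq_true, if_false, Nat.cast_one, Nat.cast_ofNat,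
        zpow_add₀ hr, zpow_sub₀ hr, zpow_natCast, zpow_ofNat, zpow_one]
      field_simp
      ring
    · simp (disch := omega) only [vecJHead, vecJTerm, w, wHat, map_add, map_sub, map_smul, hf,
        smul_eq_mul, gramHat, if_pos, if_neg, if_true, Bool.false_eq_true, if_false, Nat.cast_one,
        Nat.cast_ofNat, hz, zpow_add₀ hr, zpow_sub₀ hr, zpow_natCast, zpow_ofNat, zpow_one, hl']
      field_simp
      ring

theorem vecJ_apply_of_gramHat_four_five (hr : r ≠ 0) (hl : l ≠ 0) (hn : 5 ≤ n)
    (h : l = -(1 / r ^ (2 * (n : ℤ) - 5)))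
    {f : Module.Dual F (Space F n)}
    (hf : ∀ b s t, 1 ≤ s → s < t → t ≤ n → f (wBar F n b s t) = gramHat l r 4 5 b s t) :
    f (vecJ n r) = 0 := by
  have hl' := inv_eq_of_eq_neg_zpow hr h
  have hz := zpow_two_mul_sub_six (n := n) hr
  refine vecJ_apply_eq_zero hr (by omega) f (fun _ => 0) ?_ ?_
  · intro t ht htn
    -- The table has different branches at t = j = 5 and beyond, but in both the values at s = 3 are
    -- r times those at s = 2.
    obtain rfl | ht : t = 5 ∨ 5 < t := by omega
    all_goals
      simp (disch := omega) only [vecJTerm, w, wHat, map_sub, map_smul, hf, smul_eq_mul, gramHat,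
        if_pos, if_neg, if_true, Bool.false_eq_true, if_false, Nat.cast_one, Nat.cast_ofNat,
        zpow_add₀ hr, zpow_sub₀ hr, zpow_natCast, zpow_ofNat, zpow_one]
      field_simp
      ring
  · simp (disch := omega) only [vecJHead, vecJTerm, w, wHat, map_add, map_sub, map_smul, hf,
      smul_eq_mul, gramHat, if_pos, if_neg, if_true, Bool.false_eq_true, if_false, Nat.cast_one,
      Nat.cast_ofNat, hz, zpow_add₀ hr, zpow_sub₀ hr, zpow_natCast, zpow_ofNat, zpow_one, hl']
    field_simp
    ring

/-- A trailing factor ν_k⁻¹ with k ≥ 5 only multiplies the value at J_n by r⁻¹ and may be removed;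
φ_k with k ≥ 5 vanishes at J_n. This reduces to the forms with j ≤ 4 and one exception. -/
theorem vecJ_mem_K (hn : 4 ≤ n) (hr : r ≠ 0) (hr2 : r ^ 2 ≠ 1) (hl : l ≠ 0)
    (h : l = -(1 / r ^ (2 * (n : ℤ) - 5))) : vecJ n r ∈ K (rep hn hr hr2 hl) := by
  refine (mem_K_iff hn hr hr2 hl).2 ⟨fun i d hi hd => ?_, fun d e he hd => ?_⟩
  · induction d with
    | zero =>
      obtain h3 | h3 : i ≤ 3 ∨ 4 ≤ i := by omega
      · exact vecJ_apply_of_gram hr hl hn h hi (by omega) (by omega) (form_wBar hr hl hi hd)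
      · exact phi_vecJ hr hl hn (by omega) (by omega)
    | succ d ih =>
      obtain h3 | h3 : i + d + 2 ≤ 4 ∨ 5 ≤ i + d + 2 := by omega
      · exact vecJ_apply_of_gram hr hl hn h hi (by omega) (by omega) (form_wBar hr hl hi hd)
      · rw [form, LinearMap.comp_apply, nuInv_vecJ hr hl hn h3 (by omega), map_smul,
          ih (by omega), smul_zero]
  · have key : ∀ d e, e ≤ d → d + 2 ≤ n → e ≤ 3 → formHat n l r d e (vecJ n r) = 0 := by
      intro d e he hd h3
      induction d with
      | zero =>
        exact vecJ_apply_of_gramHat hr hl hn h (by omega) (by omega) (by omega)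
          (formHat_wBar hr hl he hd)
      | succ d ih =>
        -- The exception is Ĉ_{45}: its string ends in ν_4⁻¹, and ν_5⁻¹ cannot be moved to the end,
        -- because lowering the right index to 4 would make it equal to the left one.
        obtain h4 | ⟨h4, h5⟩ | h4 : d + 3 ≤ 4 ∨ (d = 2 ∧ e = 3) ∨ (5 ≤ d + 3 ∧ e ≤ d) := by omega
        · exact vecJ_apply_of_gramHat hr hl hn h (by omega) (by omega) (by omega)
            (formHat_wBar hr hl he hd)
        · subst h4 h5
          exact vecJ_apply_of_gramHat_four_five hr hl (by omega) h (formHat_wBar hr hl he hd)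
        · rw [← formHat_comp_nuInv_right hr hl (by omega) hd h4.2, LinearMap.comp_apply,
            nuInv_vecJ hr hl hn h4.1 (by omega), map_smul, ih h4.2 (by omega), smul_zero]
    induction e with
    | zero => exact key d 0 he hd (by omega)
    | succ e ih =>
      obtain h3 | h3 : e + 1 ≤ 3 ∨ 5 ≤ e + 2 := by omega
      · exact key d (e + 1) he hd h3
      · rw [formHat, LinearMap.comp_apply, nuInv_vecJ hr hl hn h3 (by omega), map_smul,
          ih (by omega), smul_zero]

end VectorJ

end CohenWales

theorem theorem10 {F : Type*} [Field F] {l r : F} (hr : r ≠ 0) (hr2 : r ^ 2 ≠ 1) (hl : l ≠ 0)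
    {n : ℕ} (hn : 4 ≤ n) :
    (∀ a : CohenWales.CGW F n l (r⁻¹ - r), ∀ x ∈ CohenWales.K (CohenWales.rep hn hr hr2 hl),
      CohenWales.rep hn hr hr2 hl a x ∈ CohenWales.K (CohenWales.rep hn hr hr2 hl)) ∧
    (l = r ^ 3 →
      CohenWales.vecX n r ∈ CohenWales.K (CohenWales.rep hn hr hr2 hl) ∧
      CohenWales.vecX n r ≠ 0 ∧
      CohenWales.IsReducible (CohenWales.rep hn hr hr2 hl)) ∧
    (l = -r ^ 3 →
      (5 ≤ n →
        CohenWales.vecY n r ∈ CohenWales.K (CohenWales.rep hn hr hr2 hl) ∧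
        CohenWales.vecY n r ≠ 0) ∧
      (n = 4 →
        CohenWales.vecZ n r ∈ CohenWales.K (CohenWales.rep hn hr hr2 hl) ∧
        CohenWales.vecZ n r ≠ 0) ∧
      CohenWales.IsReducible (CohenWales.rep hn hr hr2 hl)) ∧
    (l = -(1 / r ^ (2 * (n : ℤ) - 5)) →
      CohenWales.vecJ n r ∈ CohenWales.K (CohenWales.rep hn hr hr2 hl) ∧
      CohenWales.vecJ n r ≠ 0 ∧
      CohenWales.IsReducible (CohenWales.rep hn hr hr2 hl)) := by
  refine ⟨CohenWales.rep_apply_mem_K hn hr hr2 hl, fun h => ?_,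
    fun h => ⟨fun hn5 => ?_, fun _ => ?_, ?_⟩, fun h => ?_⟩
  · have hX := CohenWales.vecX_mem_K hn hr hr2 hl h
    exact ⟨hX, CohenWales.vecX_ne_zero hn,
      CohenWales.isReducible_of_mem_K hn hr hr2 hl hX (CohenWales.vecX_ne_zero hn)⟩
  · exact ⟨CohenWales.vecY_mem_K hn hr hr2 hl h hn5, CohenWales.vecY_ne_zero hn5⟩
  · exact ⟨CohenWales.vecZ_mem_K hn hr hr2 hl h, CohenWales.vecZ_ne_zero hn⟩
  · exact CohenWales.isReducible_of_mem_K hn hr hr2 hl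
      (CohenWales.vecZ_mem_K hn hr hr2 hl h) (CohenWales.vecZ_ne_zero hn)
  · have hJ := CohenWales.vecJ_mem_K hn hr hr2 hl h
    exact ⟨hJ, CohenWales.vecJ_ne_zero hn,
      CohenWales.isReducible_of_mem_K hn hr hr2 hl hJ (CohenWales.vecJ_ne_zero hn)⟩
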